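/- Let $0<L<\infty$, $\nu>0$, $\Omega=(-L,L)$, $X=L^2(\Omega)$, $Y=H^1(\Omega)\ (\subset C(\overline\Omega))$, and let $\partial_x$ denote the distributional derivative in $\Omega$. For a function $\psi:H\to(-\infty,\infty]$ on a real Hilbert space $H$, the subdifferential is $\partial\psi(z)=\{z^*\in H:\ \psi(z)+(z^*,y-z)_H\le\psi(y)\ \text{for all } y\in H\}$, and Mosco convergence $\psi_t\to\psi_{t_0}$ as $t\to t_0$ in $[0,1]$ means that for every sequence $t_n\in[0,1]$ with $t_n\to t_0$: $\liminf_n\psi_{t_n}(w_n)\ge\psi_{t_0}(w)$ whenever $w_n\to w$ weakly in $H$, and for every $w$ with $\psi_{t_0}(w)<\infty$ there are $w_n\to w$ in $H$ with $\psi_{t_n}(w_n)\to\psi_{t_0}(w)$. Assumptions on $f^\varepsilon$. Let $f^0(r)=|r|$, and for $\varepsilon\in(0,1]$ let $f^\varepsilon\in C^2(\mathbb R)$ be convex with $f^\varepsilon(0)=0$, $f^\varepsilon\ge 0$, such that: for every $\varepsilon_0\in[0,1]$, $f^\varepsilon\to f^{\varepsilon_0}$ pointwise on $\mathbb R$ and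 in the sense of Mosco on $\mathbb R$ as $\varepsilon\to\varepsilon_0$; there is $C_0>0$ with $|(f^\varepsilon)'(r)|\le C_0(1+|r|)$ for all $r\in\mathbb R$, $\varepsilon\in(0,1]$; and for every $\lambda>0$, $(f^\varepsilon)''\to0$ uniformly on $\{|r|\ge\lambda\}$ as $\varepsilon\downarrow0$. Assumptions on $\hat K^\delta$. Let $\hat K^0=I_{[-1,1]}$ be the indicator function ($0$ on $[-1,1]$, $\infty$ elsewhere) and $K^0=\partial I_{[-1,1]}$. For $\delta\in(0,1]$ let $\hat K^\delta\in C^2(\mathbb R)$ be real-valued and $K^\delta=(\hat K^\delta)'$ (regarded as a single-valued graph), such that $\hat K^\delta=0$ on $[-1,1]$; for each $\delta\in(0,1]$ there is $C^\delta_K>0$ with $0\le(K^\delta)'\le C_K^\delta$ on $\mathbb R$; for every $\delta_0\in[0,1]$, $\hat K^\delta\to\hat K^{\delta_0}$ on $\mathbb R$ in the sense of Mosco as $\delta\to\delta_0$; and for every $\delta_0\in(0,1]$, $\hat K^\delta\to\hat K^{\delta_0}$ locally uniformly on $\mathbb R$ as $\delta\to\delta_0$. Energies. On $X$ define $$V^0(z)=\sup\Big\{\int_\Omega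 z\,\partial_x\varphi\,dx:\ \varphi\in Y\cap C_c(\Omega),\ |\varphi|\le1\Big\},$$ and, for $\varepsilon\in(0,1]$, $V^\varepsilon(z)=\int_\Omega f^\varepsilon(\partial_xz)\,dx$ if $z\in Y$ and $V^\varepsilon(z)=\infty$ otherwise. Let $V^D(z)=\frac{\nu^2}{2}\int_\Omega|\partial_xz|^2dx$ if $z\in Y$, $V^D(z)=\infty$ otherwise; let $\hat{\mathcal K}^\delta(z)=\int_\Omega\hat K^\delta(z)\,dx\in[0,\infty]$ for $z\in X$, and $\mathcal K^\delta=\partial\hat{\mathcal K}^\delta$ in $X\times X$. For $\varepsilon,\delta\in[0,1]$ put $\Psi^{(\varepsilon,\delta)}(z)=V^\varepsilon(z)+V^D(z)+\hat{\mathcal K}^\delta(z)$ if $z\in Y$ and $\Psi^{(\varepsilon,\delta)}(z)=\infty$ otherwise. Theorem. For every $\varepsilon,\delta\in[0,1]$ the following hold. (i) For all $z,z^*\in X$, one has $z^*\in\partial\Psi^{(\varepsilon,\delta)}(z)$ if and only if $z\in H^2(\Omega)$ and there exist $\varpi^*\in H^1(\Omega)\cap L^\infty(\Omega)$ and $\xi\in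 L^2(\Omega)$ such that $\varpi^*\in\partial f^\varepsilon(\partial_xz)$ and $\xi\in K^\delta(z)$ a.e. in $\Omega$, $(\varpi^*+\nu^2\partial_xz)(\pm L)=0$, and $$z^*=-\partial_x\varpi^*-\nu^2\partial_x^2z+\xi\quad\text{in }X.$$ (ii) $\partial\Psi^{(\varepsilon,\delta)}=\partial V^\varepsilon+\partial V^D+\mathcal K^\delta$ in $X\times X$, i.e. for every $z\in X$ the set $\partial\Psi^{(\varepsilon,\delta)}(z)$ is the Minkowski sum $\partial V^\varepsilon(z)+\partial V^D(z)+\mathcal K^\delta(z)$ (which is empty if one of the three sets is empty). -/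

import Mathlib

open MeasureTheory Set Filter Topology
open scoped ENNReal ContDiff Pointwise

noncomputable section

namespace QuasilinearEnergy

/-! ### Convex analysis on a real Hilbert space -/

section ConvexAnalysis

variable {H : Type*} [NormedAddCommGroup H] [InnerProductSpace ℝ H]

/-- The subdifferential `∂ψ(z)` of a function `ψ : H → (-∞, ∞]`. -/
def subdifferential (ψ : H → EReal) (z : H) : Set H :=
  {zs | ∀ y : H, ψ z + ((inner ℝ zs (y - z) : ℝ) : EReal) ≤ ψ y}

/-- Weak convergence of a sequence in `H`. -/
def WeaklyTendsto (w : ℕ → H) (w₀ : H) : Prop :=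
  ∀ y : H, Tendsto (fun n => inner ℝ y (w n)) atTop (𝓝 (inner ℝ y w₀))

/-- Mosco convergence of a sequence of functions on `H`: lower bound along weakly convergent
sequences, and existence of strongly convergent recovery sequences on the effective domain. -/
def MoscoTendsto (ψs : ℕ → H → EReal) (ψ : H → EReal) : Prop :=
  (∀ (w : ℕ → H) (w₀ : H), WeaklyTendsto w w₀ →
      ψ w₀ ≤ liminf (fun n => ψs n (w n)) atTop) ∧
  (∀ w₀ : H, ψ w₀ < ⊤ → ∃ w : ℕ → H,
      Tendsto w atTop (𝓝 w₀) ∧ Tendsto (fun n => ψs n (w n)) atTop (𝓝 (ψ w₀)))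

/-- Mosco convergence `ψ t → ψ t₀` as `t → t₀` in `Λ`, for a family with a continuous parameter:
Mosco convergence along all sequences of parameters in `Λ` that converge to `t₀`. -/
def MoscoTendstoWithin (ψ : ℝ → H → EReal) (Λ : Set ℝ) (t₀ : ℝ) : Prop :=
  ∀ t : ℕ → ℝ, (∀ n, t n ∈ Λ) → Tendsto t atTop (𝓝 t₀) →
    MoscoTendsto (fun n => ψ (t n)) (ψ t₀)

end ConvexAnalysis

/-! ### Standing assumptions on the regularizing families -/

/-- The assumptions on the convex regularizations `f ε`, `ε ∈ (0, 1]`, of the absolute value. -/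
structure IsAbsRegularization (f : ℝ → ℝ → ℝ) : Prop where
  zero_param : ∀ r, f 0 r = |r|
  contDiff : ∀ ε ∈ Ioc (0 : ℝ) 1, ContDiff ℝ 2 (f ε)
  convex : ∀ ε ∈ Ioc (0 : ℝ) 1, ConvexOn ℝ univ (f ε)
  map_zero : ∀ ε ∈ Ioc (0 : ℝ) 1, f ε 0 = 0
  nonneg : ∀ ε ∈ Ioc (0 : ℝ) 1, ∀ r, 0 ≤ f ε r
  tendsto_pointwise : ∀ ε₀ ∈ Icc (0 : ℝ) 1, ∀ r,
    Tendsto (fun ε => f ε r) (𝓝[Icc 0 1] ε₀) (𝓝 (f ε₀ r))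
  tendsto_mosco : ∀ ε₀ ∈ Icc (0 : ℝ) 1,
    MoscoTendstoWithin (fun ε (r : ℝ) => ((f ε r : ℝ) : EReal)) (Icc 0 1) ε₀
  deriv_growth : ∃ C₀ : ℝ, 0 < C₀ ∧
    ∀ ε ∈ Ioc (0 : ℝ) 1, ∀ r, |deriv (f ε) r| ≤ C₀ * (1 + |r|)
  deriv_two_tendsto : ∀ lam : ℝ, 0 < lam →
    TendstoUniformlyOn (fun ε => deriv (deriv (f ε))) (fun _ => 0) (𝓝[Ioc 0 1] 0)
      {r : ℝ | lam ≤ |r|}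

open Classical in
/-- The indicator function `I_{[-1, 1]}` of convex analysis. -/
def convexIndicator (r : ℝ) : EReal := if r ∈ Icc (-1 : ℝ) 1 then 0 else ⊤

/-- The potentials for all parameters `δ ∈ [0, 1]`: the indicator function of `[-1, 1]` for
`δ = 0`, and the given function `Khat δ` for `δ ≠ 0`. -/
def potential (Khat : ℝ → ℝ → ℝ) (δ : ℝ) (r : ℝ) : EReal :=
  if δ = 0 then convexIndicator r else ((Khat δ r : ℝ) : EReal)

/-- The set-valued function `K^δ`: the subdifferential of `I_{[-1, 1]}` for `δ = 0`, and the
(single-valued) derivative of `Khat δ` for `δ ≠ 0`. -/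
def constraintGraph (Khat : ℝ → ℝ → ℝ) (δ : ℝ) (r : ℝ) : Set ℝ :=
  if δ = 0 then subdifferential convexIndicator r else {deriv (Khat δ) r}

/-- The assumptions on the regularizations `Khat δ`, `δ ∈ (0, 1]`, of `I_{[-1, 1]}`. -/
structure IsIndicatorRegularization (Khat : ℝ → ℝ → ℝ) : Prop where
  contDiff : ∀ δ ∈ Ioc (0 : ℝ) 1, ContDiff ℝ 2 (Khat δ)
  eq_zero : ∀ δ ∈ Ioc (0 : ℝ) 1, ∀ r ∈ Icc (-1 : ℝ) 1, Khat δ r = 0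
  deriv_two_bound : ∀ δ ∈ Ioc (0 : ℝ) 1, ∃ C : ℝ, 0 < C ∧
    ∀ r, 0 ≤ deriv (deriv (Khat δ)) r ∧ deriv (deriv (Khat δ)) r ≤ C
  tendsto_mosco : ∀ δ₀ ∈ Icc (0 : ℝ) 1, MoscoTendstoWithin (potential Khat) (Icc 0 1) δ₀
  tendsto_locally : ∀ δ₀ ∈ Ioc (0 : ℝ) 1,
    TendstoLocallyUniformly Khat (Khat δ₀) (𝓝[Ioc 0 1] δ₀)

/-! ### Function spaces on the interval `Ω = (-L, L)` -/

/-- Lebesgue measure on `Ω = (-L, L)`. -/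
abbrev omegaMeasure (L : ℝ) : Measure ℝ := volume.restrict (Ioo (-L) L)

/-- The Hilbert space `X = L²(Ω)`. -/
abbrev X (L : ℝ) : Type := Lp ℝ 2 (omegaMeasure L)

/-- `g ∈ L²(Ω)` is the distributional derivative of `z ∈ L²(Ω)` in `Ω`. -/
def IsWeakDeriv {L : ℝ} (z g : X L) : Prop :=
  ∀ φ : ℝ → ℝ, ContDiff ℝ ∞ φ → HasCompactSupport φ → tsupport φ ⊆ Ioo (-L) L →
    ∫ x in Ioo (-L) L, z x * deriv φ x = -∫ x in Ioo (-L) L, g x * φ x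

/-- `Y = H¹(Ω)`. -/
def H1 (L : ℝ) : Set (X L) := {z | ∃ g : X L, IsWeakDeriv z g}

open Classical in
/-- The distributional derivative `∂ₓz ∈ L²(Ω)` of `z ∈ H¹(Ω)` (zero outside `H¹(Ω)`). -/
def weakDeriv {L : ℝ} (z : X L) : X L :=
  if h : ∃ g : X L, IsWeakDeriv z g then h.choose else 0

/-- `H²(Ω)`. -/
def H2 (L : ℝ) : Set (X L) := {z | z ∈ H1 L ∧ weakDeriv z ∈ H1 L}

/-- `w(±L) = 0` for (the representative in `C([-L, L])` of) `w`. -/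
def VanishesAtBoundary {L : ℝ} (w : X L) : Prop :=
  ∃ c : ℝ → ℝ, ContinuousOn c (Icc (-L) L) ∧ (∀ᵐ x ∂(omegaMeasure L), w x = c x) ∧
    c (-L) = 0 ∧ c L = 0

/-! ### The energies -/

/-- `∫_Ω h(z) dx ∈ [0, ∞]` for a function `h : ℝ → [0, ∞]`. -/
def integralFunctional {L : ℝ} (h : ℝ → EReal) (z : X L) : EReal :=
  ((∫⁻ x, (h (z x)).toENNReal ∂(omegaMeasure L) : ℝ≥0∞) : EReal)

/-- The total variation `V⁰(z) = sup {∫_Ω z ∂ₓφ dx}`, over `φ ∈ H¹(Ω) ∩ C_c(Ω)` with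
`|φ| ≤ 1` on `[-L, L]`. -/
def totalVariation {L : ℝ} (z : X L) : EReal :=
  sSup {a : EReal | ∃ (φ : X L) (c : ℝ → ℝ), φ ∈ H1 L ∧ (∀ᵐ x ∂(omegaMeasure L), φ x = c x) ∧
    Continuous c ∧ HasCompactSupport c ∧ tsupport c ⊆ Ioo (-L) L ∧
    (∀ x ∈ Icc (-L) L, |c x| ≤ 1) ∧
    a = ((∫ x in Ioo (-L) L, z x * weakDeriv φ x : ℝ) : EReal)}

open Classical in
/-- `V^ε`: the total variation for `ε = 0`; for `ε ≠ 0`, `∫_Ω f^ε(∂ₓz) dx` on `H¹(Ω)` and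
`∞` elsewhere. -/
def V {L : ℝ} (f : ℝ → ℝ → ℝ) (ε : ℝ) (z : X L) : EReal :=
  if ε = 0 then totalVariation z
  else if z ∈ H1 L then integralFunctional (fun r => ((f ε r : ℝ) : EReal)) (weakDeriv z)
  else ⊤

open Classical in
/-- `V^D(z) = (ν² / 2) ∫_Ω |∂ₓz|² dx` on `H¹(Ω)`, and `∞` elsewhere. -/
def VD {L : ℝ} (ν : ℝ) (z : X L) : EReal :=
  if z ∈ H1 L then
    ((ν ^ 2 / 2 * ∫ x in Ioo (-L) L, |weakDeriv z x| ^ 2 : ℝ) : EReal)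
  else ⊤

/-- `Φ^ε = V^ε + V^D`. -/
def Phi {L : ℝ} (f : ℝ → ℝ → ℝ) (ν ε : ℝ) (z : X L) : EReal := V f ε z + VD ν z

/-- The functional `z ↦ ∫_Ω Khat^δ(z) dx`, whose subdifferential is the operator `𝒦^δ`. -/
def constraintEnergy {L : ℝ} (Khat : ℝ → ℝ → ℝ) (δ : ℝ) (z : X L) : EReal :=
  integralFunctional (potential Khat δ) z

open Classical in
/-- The energy `Ψ^(ε,δ)`: `Φ^ε + ∫_Ω Khat^δ(·) dx` on `H¹(Ω)`, and `∞` elsewhere. -/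
def Psi {L : ℝ} (f Khat : ℝ → ℝ → ℝ) (ν ε δ : ℝ) (z : X L) : EReal :=
  if z ∈ H1 L then Phi f ν ε z + constraintEnergy Khat δ z else ⊤

end QuasilinearEnergy

end

open QuasilinearEnergy

noncomputable section

namespace QuasilinearEnergy

variable {L : ℝ}

/-! ### Absolutely continuous representatives -/

/-! On `H¹(Ω)` the energy is `∫ g(∂ₓz)` plus a zero-order term, where `g(r) = f^ε(r) + ν²r²/2`; for
`ε = 0` this rests on `V⁰(z) = ∫ |∂ₓz|` (`totalVariation_eq`). Both claims follow from a circle of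
inclusions: `∂Ψ(z)` lies in the set of elements decomposed as in (i), this set lies in the sum of
the three subdifferentials, and that sum lies in `∂Ψ(z)` by adding inequalities.

First inclusion. A Moreau-Rockafellar argument (`exists_subgradient_of_add`) splits off a multiplier
`ξ` for the zero-order term. For `δ > 0` this term is continuous on `X`. For `δ = 0` it is not, and
an exact penalty replaces it: truncation to `[-1, 1]` does not raise the gradient energy, and the
linear term that truncation loses is bounded by the penalty. Then `z* - ξ` is a subgradient of the
gradient energy alone. Since `∂ₓ` maps `H¹` onto `L²`, the inequality localizes: the primitive `W`
of `-(z* - ξ)` vanishing at `-L` lies in `∂g(∂ₓz)` a.e., and constant perturbations give `W(L) = 0`.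
Because `∂g` is strongly monotone with constant `ν²`, `∂ₓz` is a Lipschitz function of `W`; hence `z
∈ H²` and `ϖ* = W - ν²∂ₓz`.

Second inclusion. As `0` minimizes `f^ε`, the product `ϖ*∂ₓz` is nonnegative, so the boundary
condition forces both factors to vanish at `±L` (`boundary_values_eq_zero`). Integration by parts
then puts `-∂ₓϖ*` and `-ν²∂ₓ²z` in their own subdifferentials. For `ε = 0` competitors outside `H¹`
matter too, and `ϖ*` is approximated by admissible test functions of the total variation
(`coe_neg_integral_le_totalVariation`). -/

lemma ae_omega_iff {p : ℝ → Prop} :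
    (∀ᵐ x ∂(omegaMeasure L), p x) ↔ ∀ᵐ x, x ∈ Ioo (-L) L → p x :=
  ae_restrict_iff' measurableSet_Ioo

lemma integral_omega_eq (hL : 0 < L) (h : ℝ → ℝ) :
    ∫ x in Ioo (-L) L, h x = ∫ x in (-L)..L, h x := by
  rw [intervalIntegral.integral_of_le (by linarith), integral_Ioc_eq_integral_Ioo]

lemma integrable_omega_iff (hL : 0 < L) {h : ℝ → ℝ} :
    Integrable h (omegaMeasure L) ↔ IntervalIntegrable h volume (-L) L := by
  rw [intervalIntegrable_iff_integrableOn_Ioo_of_le (by linarith)]; rfl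

lemma X.integrable (g : X L) : Integrable g (omegaMeasure L) :=
  (Lp.memLp g).integrable one_le_two

lemma X.integrable_mul (g h : X L) : Integrable (fun x => g x * h x) (omegaMeasure L) :=
  MemLp.integrable_mul (Lp.memLp g) (Lp.memLp h)

lemma X.intervalIntegrable (hL : 0 < L) (g : X L) : IntervalIntegrable g volume (-L) L :=
  (integrable_omega_iff hL).1 g.integrable

lemma X.inner_eq (g h : X L) : (inner ℝ g h : ℝ) = ∫ x in Ioo (-L) L, g x * h x := by
  rw [L2.inner_def]
  refine integral_congr_ae (Eventually.of_forall fun x => ?_)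
  simp [mul_comm]

/-- `u` is an absolutely continuous representative of `z`, with derivative `g`. -/
structure IsRep (u : ℝ → ℝ) (z g : X L) : Prop where
  ac : AbsolutelyContinuousOnInterval u (-L) L
  ae_eq : z =ᵐ[omegaMeasure L] u
  hasDerivAt : ∀ᵐ x ∂(omegaMeasure L), HasDerivAt u (g x) x

lemma IsRep.continuousOn {u : ℝ → ℝ} {z g : X L} (hL : 0 < L) (h : IsRep u z g) :
    ContinuousOn u (Icc (-L) L) := by
  have := h.ac.continuousOn
  rwa [uIcc_of_le (by linarith)] at this

lemma IsRep.deriv_ae {u : ℝ → ℝ} {z g : X L} (h : IsRep u z g) :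
    deriv u =ᵐ[omegaMeasure L] g := by
  filter_upwards [h.hasDerivAt] with x hx using hx.deriv

lemma integral_mul_deriv_of_ac (hL : 0 < L) {u v : ℝ → ℝ}
    (hu : AbsolutelyContinuousOnInterval u (-L) L)
    (hv : AbsolutelyContinuousOnInterval v (-L) L) :
    ∫ x in Ioo (-L) L, u x * deriv v x =
      u L * v L - u (-L) * v (-L) - ∫ x in Ioo (-L) L, deriv u x * v x := by
  rw [integral_omega_eq hL, integral_omega_eq hL]
  exact hu.integral_mul_deriv_eq_deriv_mul hv

lemma IsRep.integral_mul {u v : ℝ → ℝ} {z g w h : X L} (hL : 0 < L)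
    (hu : IsRep u z g) (hv : IsRep v w h) :
    ∫ x in Ioo (-L) L, z x * h x =
      u L * v L - u (-L) * v (-L) - ∫ x in Ioo (-L) L, g x * w x := by
  have e1 : ∫ x in Ioo (-L) L, z x * h x = ∫ x in Ioo (-L) L, u x * deriv v x := by
    refine integral_congr_ae ?_
    filter_upwards [hu.ae_eq, hv.deriv_ae] with x h1 h2
    rw [h1, h2]
  have e2 : ∫ x in Ioo (-L) L, g x * w x = ∫ x in Ioo (-L) L, deriv u x * v x := by
    refine integral_congr_ae ?_
    filter_upwards [hu.deriv_ae, hv.ae_eq] with x h1 h2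
    rw [h1, h2]
  rw [e1, e2, integral_mul_deriv_of_ac hL hu.ac hv.ac]

lemma eq_zero_of_tsupport_subset {φ : ℝ → ℝ} {s : Set ℝ} (h : tsupport φ ⊆ s) {x : ℝ}
    (hx : x ∉ s) : φ x = 0 :=
  image_eq_zero_of_notMem_tsupport fun hx' => hx (h hx')

lemma IsRep.isWeakDeriv {u : ℝ → ℝ} {z g : X L} (hL : 0 < L) (h : IsRep u z g) :
    IsWeakDeriv z g := by
  intro φ hφ _ hsupp
  have hac : AbsolutelyContinuousOnInterval φ (-L) L :=
    ((hφ.of_le (by norm_num)).contDiffOn).absolutelyContinuousOnInterval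
  have e1 : ∫ x in Ioo (-L) L, z x * deriv φ x = ∫ x in Ioo (-L) L, u x * deriv φ x := by
    refine integral_congr_ae ?_
    filter_upwards [h.ae_eq] with x h1
    rw [h1]
  have e2 : ∫ x in Ioo (-L) L, g x * φ x = ∫ x in Ioo (-L) L, deriv u x * φ x := by
    refine integral_congr_ae ?_
    filter_upwards [h.deriv_ae] with x h1
    rw [h1]
  rw [e1, e2, integral_mul_deriv_of_ac hL h.ac hac,
    eq_zero_of_tsupport_subset (x := L) hsupp (by simp),
    eq_zero_of_tsupport_subset (x := -L) hsupp (by simp)]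
  ring

/-- The primitive of `g` with value `c` at `-L`. -/
def primitive (c : ℝ) (g : X L) (x : ℝ) : ℝ := c + ∫ t in (-L)..x, g t

lemma memLp_of_ac (hL : 0 < L) {u : ℝ → ℝ} (hu : AbsolutelyContinuousOnInterval u (-L) L)
    (p : ℝ≥0∞) : MemLp u p (omegaMeasure L) := by
  have hc : ContinuousOn u (Icc (-L) L) := by
    have := hu.continuousOn
    rwa [uIcc_of_le (by linarith)] at this
  obtain ⟨C, hC⟩ := isCompact_Icc.exists_bound_of_continuousOn hc
  refine MemLp.of_bound ((hc.mono Ioo_subset_Icc_self).aestronglyMeasurable measurableSet_Ioo) C ?_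
  exact (ae_restrict_mem measurableSet_Ioo).mono fun x hx => hC x (Ioo_subset_Icc_self hx)

lemma exists_isRep_of_ac (hL : 0 < L) {u : ℝ → ℝ}
    (hu : AbsolutelyContinuousOnInterval u (-L) L) {g : X L}
    (hg : ∀ᵐ x ∂(omegaMeasure L), HasDerivAt u (g x) x) : ∃ z : X L, IsRep u z g :=
  ⟨(memLp_of_ac hL hu 2).toLp u, hu, MemLp.coeFn_toLp _, hg⟩

lemma exists_isRep_primitive (hL : 0 < L) (c : ℝ) (g : X L) :
    ∃ z : X L, IsRep (primitive c g) z g := by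
  have hi := g.intervalIntegrable hL
  refine exists_isRep_of_ac hL ?_ ?_
  · have hc : AbsolutelyContinuousOnInterval (fun _ : ℝ => c) (-L) L :=
      (LipschitzWith.const c).lipschitzOnWith.absolutelyContinuousOnInterval
    exact hc.add (hi.absolutelyContinuousOnInterval_intervalIntegral (c := -L) left_mem_uIcc)
  · rw [ae_omega_iff]
    filter_upwards [hi.ae_hasDerivAt_integral] with x hx hx'
    have hx'' : x ∈ uIcc (-L) L := by
      rw [uIcc_of_le (by linarith)]; exact Ioo_subset_Icc_self hx'
    exact (hx hx'' (-L) left_mem_uIcc).const_add c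

/-- The primitive based at the left end of a compact set carrying `θ` vanishes to the left of that
set, and to its right because `θ` has mean zero. The role of `ψ` is only to supply that compact set.
-/
lemma exists_smooth_primitive {θ ψ : ℝ → ℝ} {s : Set ℝ} (hθ : ContDiff ℝ ∞ θ)
    (hψc : HasCompactSupport ψ) (hs : OrdConnected s) (hψs : tsupport ψ ⊆ s)
    (hne : (tsupport ψ).Nonempty)
    (hsub : tsupport θ ⊆ tsupport ψ) (hint : ∫ x, θ x = 0) :
    ∃ φ : ℝ → ℝ, ContDiff ℝ ∞ φ ∧ HasCompactSupport φ ∧ tsupport φ ⊆ s ∧ deriv φ = θ := by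
  set K := tsupport ψ
  have hK : IsCompact K := hψc
  set a := sInf K
  set b := sSup K
  have ha : a ∈ K := hK.sInf_mem hne
  have hb : b ∈ K := hK.sSup_mem hne
  have hKab : K ⊆ Icc a b := subset_Icc_csInf_csSup hK.bddBelow hK.bddAbove
  have hθ0 : ∀ x, x ∉ Icc a b → θ x = 0 := fun x hx =>
    eq_zero_of_tsupport_subset (hsub.trans hKab) hx
  let φ : ℝ → ℝ := fun x => ∫ t in a..x, θ t
  have hd : ∀ x, HasDerivAt φ (θ x) x := fun x =>
    intervalIntegral.integral_hasDerivAt_right (hθ.continuous.intervalIntegrable _ _)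
      (hθ.continuous.stronglyMeasurableAtFilter _ _) hθ.continuous.continuousAt
  have hderiv : deriv φ = θ := funext fun x => (hd x).deriv
  have hab : a ≤ b := (hKab ha).2
  have hsupp : Function.support φ ⊆ Icc a b := by
    intro x hx
    by_contra hx'
    apply hx
    rcases lt_or_ge x a with h | h
    · change ∫ t in a..x, θ t = 0
      rw [intervalIntegral.integral_symm, intervalIntegral.integral_of_le h.le,
        integral_Ioc_eq_integral_Ioo, setIntegral_eq_zero_of_forall_eq_zero, neg_zero]
      intro y hy
      exact hθ0 y fun h' => absurd h'.1 (not_le.2 hy.2)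
    · have hxb : b < x := by
        by_contra hb'
        exact hx' ⟨h, not_lt.1 hb'⟩
      change ∫ t in a..x, θ t = 0
      rw [intervalIntegral.integral_of_le h, ← integral_Icc_eq_integral_Ioc,
        setIntegral_eq_integral_of_forall_compl_eq_zero, hint]
      intro y hy
      refine hθ0 y fun h' => hy ⟨h'.1, h'.2.trans hxb.le⟩
  have ht : tsupport φ ⊆ Icc a b := closure_minimal hsupp isClosed_Icc
  refine ⟨φ, ?_, HasCompactSupport.of_support_subset_isCompact isCompact_Icc hsupp,
    ht.trans (hs.out (hψs ha) (hψs hb)), hderiv⟩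
  rw [contDiff_infty_iff_deriv]
  exact ⟨fun x => (hd x).differentiableAt, hderiv ▸ hθ⟩

lemma integrable_mul_of_compactSupport (z : X L) {η : ℝ → ℝ} (hη : Continuous η)
    (hηc : HasCompactSupport η) : Integrable (fun x => z x * η x) (omegaMeasure L) := by
  obtain ⟨C, hC⟩ := hη.bounded_above_of_compact_support hηc
  exact z.integrable.mul_bdd (c := C) hη.aestronglyMeasurable (Eventually.of_forall hC)

/-- du Bois-Reymond: a function with vanishing weak derivative is constant. -/
lemma ae_eq_const_of_isWeakDeriv_zero (hL : 0 < L) {z : X L}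
    (h : ∀ φ : ℝ → ℝ, ContDiff ℝ ∞ φ → HasCompactSupport φ → tsupport φ ⊆ Ioo (-L) L →
      ∫ x in Ioo (-L) L, z x * deriv φ x = 0) :
    ∃ c : ℝ, ∀ᵐ x ∂(omegaMeasure L), z x = c := by
  let B : ContDiffBump (0 : ℝ) := ⟨L / 4, L / 2, by linarith, by linarith⟩
  let β : ℝ → ℝ := B.normed volume
  have hβ : ContDiff ℝ ∞ β := B.contDiff_normed
  have hβt : tsupport β = Icc (-(L / 2)) (L / 2) := by
    rw [show tsupport β = _ from B.tsupport_normed_eq, Real.closedBall_eq_Icc]; simp [B]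
  have hβc : HasCompactSupport β := B.hasCompactSupport_normed
  have hβi : ∫ x, β x = 1 := B.integral_normed
  let c := ∫ x in Ioo (-L) L, z x * β x
  refine ⟨c, ?_⟩
  have hzi : IntegrableOn z (Ioo (-L) L) := z.integrable
  have hci : IntegrableOn (fun _ : ℝ => c) (Ioo (-L) L) := integrable_const c
  have key : ∀ᵐ x, x ∈ Ioo (-L) L → z x - c = 0 := by
    refine isOpen_Ioo.ae_eq_zero_of_integral_contDiff_smul_eq_zero
      (hzi.sub hci).locallyIntegrableOn fun ψ hψ hψc hψs => ?_
    -- Subtracting the multiple of `β` with the same integral makes `θ` the derivative of a test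
    -- function.
    let θ : ℝ → ℝ := fun x => ψ x - (∫ t, ψ t) * β x
    have hθ : ContDiff ℝ ∞ θ := hψ.sub (contDiff_const.mul hβ)
    have hψi : Integrable ψ := hψ.continuous.integrable_of_hasCompactSupport hψc
    have hβint : Integrable β := hβ.continuous.integrable_of_hasCompactSupport hβc
    have hθi : ∫ x, θ x = 0 := by
      rw [integral_sub hψi (hβint.const_mul _), integral_const_mul, hβi]; ring
    -- Absolute values exclude cancellation, so the support is exactly the union; `β` keeps it
    -- nonempty even if `ψ = 0`.
    let χ : ℝ → ℝ := fun x => |ψ x| + |β x|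
    have hχ : Function.support χ = Function.support ψ ∪ Function.support β := by
      ext x
      simp only [Function.mem_support, mem_union, χ]
      constructor
      · intro hx
        by_contra! h'
        apply hx
        simp [h'.1, h'.2]
      · rintro (h' | h')
        · exact (add_pos_of_pos_of_nonneg (abs_pos.2 h') (abs_nonneg _)).ne'
        · exact (add_pos_of_nonneg_of_pos (abs_nonneg _) (abs_pos.2 h')).ne'
    have hχt : tsupport χ = tsupport ψ ∪ tsupport β := by
      unfold tsupport; rw [hχ, closure_union]
    have hθs : tsupport θ ⊆ tsupport χ := by
      refine closure_mono ?_
      intro x hx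
      rw [hχ]
      by_contra h'
      simp only [mem_union, Function.mem_support, not_or, not_not] at h'
      exact hx (by simp [θ, h'.1, h'.2])
    have hβs : tsupport β ⊆ Ioo (-L) L := by
      rw [hβt]; intro x hx; constructor <;> linarith [hx.1, hx.2]
    obtain ⟨φ, h1, h2, h3, h4⟩ := exists_smooth_primitive (s := Ioo (-L) L) (ψ := χ) hθ
      (by unfold HasCompactSupport; rw [hχt]; exact IsCompact.union hψc hβc)
      ordConnected_Ioo (by rw [hχt]; exact union_subset hψs hβs)
      (by rw [hχt, hβt]; exact ⟨0, Or.inr ⟨by linarith, by linarith⟩⟩) hθs hθi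
    have h5 := h φ h1 h2 h3
    rw [h4] at h5
    have h6 : (∫ x in Ioo (-L) L, z x * ψ x) - (∫ t, ψ t) * c = 0 := by
      rw [← h5, ← integral_const_mul, ← integral_sub
        (integrable_mul_of_compactSupport z hψ.continuous hψc)
        ((integrable_mul_of_compactSupport z hβ.continuous hβc).const_mul _)]
      refine integral_congr_ae (Eventually.of_forall fun x => ?_)
      simp only [θ]; ring
    have h7 : ∫ x in Ioo (-L) L, ψ x = ∫ x, ψ x :=
      setIntegral_eq_integral_of_forall_compl_eq_zero fun x hx =>
        eq_zero_of_tsupport_subset hψs hx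
    rw [← setIntegral_eq_integral_of_forall_compl_eq_zero (s := Ioo (-L) L)
      (fun x hx => by rw [eq_zero_of_tsupport_subset hψs hx, zero_smul])]
    calc ∫ x in Ioo (-L) L, ψ x • (z x - c)
        = ∫ x in Ioo (-L) L, (z x * ψ x - c * ψ x) := by
          refine integral_congr_ae (Eventually.of_forall fun x => ?_)
          simp only [smul_eq_mul]; ring
      _ = 0 := by
          rw [integral_sub (integrable_mul_of_compactSupport z hψ.continuous hψc)
            (hψi.integrableOn.const_mul _),
            integral_const_mul, h7]
          linarith
  rw [ae_omega_iff]
  filter_upwards [key] with x hx hx'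
  linarith [hx hx']

/-- The difference of `z` and a primitive of `g` has zero weak derivative, hence is a constant,
which is added back. -/
lemma IsWeakDeriv.exists_isRep (hL : 0 < L) {z g : X L} (h : IsWeakDeriv z g) :
    ∃ u, IsRep u z g := by
  obtain ⟨z₀, hz₀⟩ := exists_isRep_primitive hL 0 g
  obtain ⟨c, hc⟩ := ae_eq_const_of_isWeakDeriv_zero hL (z := z - z₀) (by
    intro φ h1 h2 h3
    have h4 := h φ h1 h2 h3
    have h5 := hz₀.isWeakDeriv hL φ h1 h2 h3
    have h6 : Continuous (deriv φ) := h1.continuous_deriv (by norm_num)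
    have : ∫ x in Ioo (-L) L, (z - z₀ : X L) x * deriv φ x =
        ∫ x in Ioo (-L) L, (z x * deriv φ x - z₀ x * deriv φ x) := by
      refine integral_congr_ae ?_
      filter_upwards [Lp.coeFn_sub z z₀] with x hx
      rw [hx, Pi.sub_apply]; ring
    rw [this, integral_sub (integrable_mul_of_compactSupport z h6 h2.deriv)
      (integrable_mul_of_compactSupport z₀ h6 h2.deriv), h4, h5, sub_self])
  refine ⟨fun x => c + primitive 0 g x, ?_, ?_, ?_⟩
  · have hc : AbsolutelyContinuousOnInterval (fun _ : ℝ => c) (-L) L :=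
      (LipschitzWith.const c).lipschitzOnWith.absolutelyContinuousOnInterval
    exact hc.add hz₀.ac
  · filter_upwards [hc, Lp.coeFn_sub z z₀, hz₀.ae_eq] with x h1 h2 h3
    rw [h2, Pi.sub_apply, h3] at h1
    linarith
  · filter_upwards [hz₀.hasDerivAt] with x hx using hx.const_add c

lemma IsWeakDeriv.unique {z g g' : X L} (h : IsWeakDeriv z g) (h' : IsWeakDeriv z g') :
    g = g' := by
  have hi : ∀ k : X L, IntegrableOn k (Ioo (-L) L) := fun k => k.integrable
  have key : ∀ᵐ x, x ∈ Ioo (-L) L → g x - g' x = 0 := by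
    refine isOpen_Ioo.ae_eq_zero_of_integral_contDiff_smul_eq_zero
      ((hi g).sub (hi g')).locallyIntegrableOn fun ψ hψ hψc hψs => ?_
    have h1 := h ψ hψ hψc hψs
    have h2 := h' ψ hψ hψc hψs
    rw [← setIntegral_eq_integral_of_forall_compl_eq_zero (s := Ioo (-L) L)
      (fun x hx => by rw [eq_zero_of_tsupport_subset hψs hx, zero_smul])]
    calc ∫ x in Ioo (-L) L, ψ x • (g x - g' x)
        = ∫ x in Ioo (-L) L, (g x * ψ x - g' x * ψ x) := by
          refine integral_congr_ae (Eventually.of_forall fun x => ?_)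
          simp only [smul_eq_mul]; ring
      _ = 0 := by
          rw [integral_sub (integrable_mul_of_compactSupport g hψ.continuous hψc)
            (integrable_mul_of_compactSupport g' hψ.continuous hψc)]
          linarith
  refine Lp.ext ?_
  change ∀ᵐ x ∂(omegaMeasure L), _
  rw [ae_omega_iff]
  filter_upwards [key] with x hx hx'
  linarith [hx hx']

/-- Uniqueness makes the choice in `weakDeriv` immaterial. -/
lemma IsWeakDeriv.weakDeriv_eq {z g : X L} (h : IsWeakDeriv z g) : weakDeriv z = g := by
  have hex : ∃ g : X L, IsWeakDeriv z g := ⟨g, h⟩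
  rw [weakDeriv, dif_pos hex]
  exact hex.choose_spec.unique h

lemma IsRep.weakDeriv_eq {u : ℝ → ℝ} {z g : X L} (hL : 0 < L) (h : IsRep u z g) :
    weakDeriv z = g := (h.isWeakDeriv hL).weakDeriv_eq

lemma IsRep.mem_H1 {u : ℝ → ℝ} {z g : X L} (hL : 0 < L) (h : IsRep u z g) : z ∈ H1 L :=
  ⟨g, h.isWeakDeriv hL⟩

lemma exists_isRep_of_mem_H1 (hL : 0 < L) {z : X L} (h : z ∈ H1 L) :
    ∃ u, IsRep u z (weakDeriv z) := by
  obtain ⟨g, hg⟩ := h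
  rw [hg.weakDeriv_eq]
  exact hg.exists_isRep hL

/-! ### Linear and Lipschitz calculus in `H¹(Ω)`. -/

lemma IsRep.add {u v : ℝ → ℝ} {z g w h : X L} (hu : IsRep u z g) (hv : IsRep v w h) :
    IsRep (fun x => u x + v x) (z + w) (g + h) where
  ac := hu.ac.add hv.ac
  ae_eq := by
    filter_upwards [Lp.coeFn_add z w, hu.ae_eq, hv.ae_eq] with x h1 h2 h3
    rw [h1, Pi.add_apply, h2, h3]
  hasDerivAt := by
    filter_upwards [Lp.coeFn_add g h, hu.hasDerivAt, hv.hasDerivAt] with x h1 h2 h3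
    rw [h1]
    exact h2.add h3

lemma IsRep.smul {u : ℝ → ℝ} {z g : X L} (hu : IsRep u z g) (c : ℝ) :
    IsRep (fun x => c * u x) (c • z) (c • g) where
  ac := hu.ac.const_mul c
  ae_eq := by
    filter_upwards [Lp.coeFn_smul c z, hu.ae_eq] with x h1 h2
    rw [h1, Pi.smul_apply, h2, smul_eq_mul]
  hasDerivAt := by
    filter_upwards [Lp.coeFn_smul c g, hu.hasDerivAt] with x h1 h2
    rw [h1]
    exact h2.const_mul c

lemma weakDeriv_add (hL : 0 < L) {z w : X L} (hz : z ∈ H1 L) (hw : w ∈ H1 L) :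
    z + w ∈ H1 L ∧ weakDeriv (z + w) = weakDeriv z + weakDeriv w := by
  obtain ⟨u, hu⟩ := exists_isRep_of_mem_H1 hL hz
  obtain ⟨v, hv⟩ := exists_isRep_of_mem_H1 hL hw
  exact ⟨(hu.add hv).mem_H1 hL, (hu.add hv).weakDeriv_eq hL⟩

lemma weakDeriv_smul (hL : 0 < L) {z : X L} (hz : z ∈ H1 L) (c : ℝ) :
    c • z ∈ H1 L ∧ weakDeriv (c • z) = c • weakDeriv z := by
  obtain ⟨u, hu⟩ := exists_isRep_of_mem_H1 hL hz
  exact ⟨(hu.smul c).mem_H1 hL, (hu.smul c).weakDeriv_eq hL⟩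

lemma weakDeriv_sub (hL : 0 < L) {z w : X L} (hz : z ∈ H1 L) (hw : w ∈ H1 L) :
    z - w ∈ H1 L ∧ weakDeriv (z - w) = weakDeriv z - weakDeriv w := by
  have h1 := weakDeriv_smul hL hw (-1)
  have h2 := weakDeriv_add hL hz h1.1
  rw [h1.2] at h2
  simpa [sub_eq_add_neg] using h2

lemma weakDeriv_zero (hL : 0 < L) : (0 : X L) ∈ H1 L ∧ weakDeriv (0 : X L) = 0 := by
  obtain ⟨z, hz⟩ := exists_isRep_primitive hL 0 (0 : X L)
  simpa using weakDeriv_smul hL (hz.mem_H1 hL) 0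

/-- The composition of a Lipschitz function with an absolutely continuous function. -/
lemma _root_.LipschitzWith.comp_absolutelyContinuousOnInterval {S u : ℝ → ℝ} {K : NNReal}
    {a b : ℝ} (hS : LipschitzWith K S) (hu : AbsolutelyContinuousOnInterval u a b) :
    AbsolutelyContinuousOnInterval (fun x => S (u x)) a b := by
  rw [absolutelyContinuousOnInterval_iff] at hu ⊢
  intro ε hε
  -- `K + 1` in place of `K` keeps the denominator positive when `K = 0`.
  obtain ⟨η, hη, H⟩ := hu (ε / (K + 1)) (by positivity)
  refine ⟨η, hη, fun E hE hlt => ?_⟩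
  calc ∑ i ∈ Finset.range E.1, dist (S (u (E.2 i).1)) (S (u (E.2 i).2))
      ≤ ∑ i ∈ Finset.range E.1, (K + 1 : ℝ) * dist (u (E.2 i).1) (u (E.2 i).2) := by
        refine Finset.sum_le_sum fun i _ => (hS.dist_le_mul _ _).trans ?_
        gcongr; linarith
    _ = (K + 1 : ℝ) * ∑ i ∈ Finset.range E.1, dist (u (E.2 i).1) (u (E.2 i).2) := by
        rw [Finset.mul_sum]
    _ < (K + 1 : ℝ) * (ε / (K + 1)) := by
        have := H E hE hlt
        gcongr
    _ = ε := by field_simp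

/-- The composition of a Lipschitz function with a function in `H¹` is in `H¹`. -/
lemma IsRep.exists_lipschitz_comp {S u : ℝ → ℝ} {z g : X L} {K : NNReal} (hL : 0 < L)
    (hu : IsRep u z g) (hS : LipschitzWith K S) :
    ∃ w h : X L, IsRep (fun x => S (u x)) w h := by
  have hac := hS.comp_absolutelyContinuousOnInterval hu.ac
  set v : ℝ → ℝ := fun x => S (u x) with hv
  have hdiff : ∀ᵐ x ∂(omegaMeasure L), DifferentiableAt ℝ v x := by
    rw [ae_omega_iff]
    filter_upwards [hac.ae_differentiableAt] with x hx hx'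
    exact hx (by rw [uIcc_of_le (by linarith)]; exact Ioo_subset_Icc_self hx')
  -- Difference quotients are compared instead of using the chain rule, since `S` may fail to be
  -- differentiable at `u x`.
  have hbound : ∀ᵐ x ∂(omegaMeasure L), ‖deriv v x‖ ≤ ‖(K : ℝ) * g x‖ := by
    filter_upwards [hdiff, hu.hasDerivAt] with x h1 h2
    have h3 := (h1.hasDerivAt.tendsto_slope).norm
    have h4 := ((h2.tendsto_slope).norm).const_mul (K : ℝ)
    rw [norm_mul, Real.norm_of_nonneg K.coe_nonneg]
    refine le_of_tendsto_of_tendsto' h3 h4 fun y => ?_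
    rw [slope_def_field, slope_def_field, norm_div, norm_div, ← mul_div_assoc]
    gcongr
    exact hS.norm_sub_le _ _
  have hmem : MemLp (deriv v) 2 (omegaMeasure L) :=
    ((Lp.memLp g).const_mul (K : ℝ)).mono (measurable_deriv v).aestronglyMeasurable hbound
  obtain ⟨w, hw⟩ := exists_isRep_of_ac hL hac (g := hmem.toLp _) (by
    filter_upwards [hdiff, hmem.coeFn_toLp] with x h1 h2
    rw [h2]; exact h1.hasDerivAt)
  exact ⟨w, _, hw⟩

/-! ### Convex integrands of quadratic growth -/

/-- Convex functions on the line of at most quadratic growth with minimal value `h 0 = 0`. -/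
structure IsQuadConvex (h : ℝ → ℝ) : Prop where
  convex : ConvexOn ℝ univ h
  nonneg : ∀ r, 0 ≤ h r
  map_zero : h 0 = 0
  growth : ∃ C : ℝ, ∀ r, h r ≤ C * (1 + r ^ 2)

lemma _root_.ConvexOn.add_deriv_mul_le {h : ℝ → ℝ} (hc : ConvexOn ℝ univ h) {d x : ℝ}
    (hd : HasDerivAt h d x) (r : ℝ) : h x + d * (r - x) ≤ h r := by
  rcases lt_trichotomy x r with hr | rfl | hr
  · have := hc.le_slope_of_hasDerivAt (mem_univ x) (mem_univ r) hr hd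
    rw [slope_def_field, le_div_iff₀ (by linarith)] at this
    linarith
  · simp
  · have := hc.slope_le_of_hasDerivAt (mem_univ r) (mem_univ x) hr hd
    rw [slope_def_field, div_le_iff₀ (by linarith)] at this
    linarith

lemma eq_deriv_of_subgradient {h : ℝ → ℝ} {d w x : ℝ} (hd : HasDerivAt h d x)
    (hw : ∀ r, h x + w * (r - x) ≤ h r) : w = d := by
  have hmin : IsLocalMin (fun r => h r - w * r) x :=
    Eventually.of_forall fun r => by have := hw r; linarith
  have := hmin.hasDerivAt_eq_zero (hd.sub ((hasDerivAt_id x).const_mul w))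
  simp at this
  linarith

lemma mem_subdifferential_coe_iff {h : ℝ → ℝ} {x w : ℝ} :
    w ∈ subdifferential (fun r : ℝ => ((h r : ℝ) : EReal)) x ↔
      ∀ r, h x + w * (r - x) ≤ h r := by
  refine forall_congr' fun r => ?_
  rw [← EReal.coe_add, EReal.coe_le_coe_iff]
  simp [mul_comm]

namespace IsQuadConvex

variable {h : ℝ → ℝ}

lemma continuous (hh : IsQuadConvex h) : Continuous h :=
  hh.convex.locallyLipschitz.continuous

lemma integrable (hh : IsQuadConvex h) (p : X L) :
    Integrable (fun x => h (p x)) (omegaMeasure L) := by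
  obtain ⟨C, hC⟩ := hh.growth
  have h1 : Integrable (fun x => C * (1 + p x ^ 2)) (omegaMeasure L) :=
    ((integrable_const 1).add (Lp.memLp p).integrable_sq).const_mul C
  refine h1.mono' (hh.continuous.comp_aestronglyMeasurable (Lp.aestronglyMeasurable p))
    (Eventually.of_forall fun x => ?_)
  rw [Real.norm_of_nonneg (hh.nonneg _)]
  exact hC _

/-- The hypothesis says that `a` lies between `0` and `b`, and a convex function with minimum at `0`
increases along rays. The product form is the one that survives limits of difference quotients. -/
lemma le_of_between (hh : IsQuadConvex h) {a b : ℝ} (hab : 0 ≤ a * (b - a)) : h a ≤ h b := by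
  by_cases hb : b = 0
  · have ha : a = 0 := by subst hb; nlinarith
    rw [ha, hb]
  · have hb2 : 0 < b ^ 2 := by positivity
    have h0 : 0 ≤ a * b := by nlinarith
    have h1 : a * b ≤ b ^ 2 := by nlinarith [sq_nonneg (b - a)]
    have hθ : a / b = a * b / b ^ 2 := by field_simp
    have hθ0 : 0 ≤ a / b := by rw [hθ]; positivity
    have hθ1 : a / b ≤ 1 := by rw [hθ]; exact div_le_one_of_le₀ h1 hb2.le
    have := hh.convex.2 (mem_univ b) (mem_univ 0) hθ0 (sub_nonneg.2 hθ1) (by ring)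
    simp only [smul_eq_mul, mul_zero, add_zero, hh.map_zero, div_mul_cancel₀ _ hb] at this
    nlinarith [hh.nonneg b]

lemma integralFunctional_eq (hh : IsQuadConvex h) (p : X L) :
    integralFunctional (fun r => ((h r : ℝ) : EReal)) p =
      ((∫ x in Ioo (-L) L, h (p x) : ℝ) : EReal) := by
  have h0 : 0 ≤ ∫ x in Ioo (-L) L, h (p x) := integral_nonneg fun x => hh.nonneg _
  unfold integralFunctional
  simp only [EReal.toENNReal_of_ne_top (EReal.coe_ne_top _), EReal.toReal_coe]
  rw [← ofReal_integral_eq_lintegral_ofReal (hh.integrable p)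
    (Eventually.of_forall fun x => hh.nonneg _), EReal.coe_ennreal_ofReal, max_eq_left h0]

lemma add_sq (hh : IsQuadConvex h) (ν : ℝ) :
    IsQuadConvex (fun r => h r + ν ^ 2 / 2 * r ^ 2) where
  convex := hh.convex.add ((Even.convexOn_pow even_two).smul (by positivity))
  nonneg r := add_nonneg (hh.nonneg r) (by positivity)
  map_zero := by simp [hh.map_zero]
  growth := by
    obtain ⟨C, hC⟩ := hh.growth
    refine ⟨C + ν ^ 2 / 2, fun r => ?_⟩
    have := hC r
    nlinarith [sq_nonneg ν]

/-- The tangent at `r`, evaluated at `0`, gives `h r ≤ h'(r) r`. -/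
lemma of_deriv {C : ℝ} (hc : ConvexOn ℝ univ h) (hd : Differentiable ℝ h)
    (hn : ∀ r, 0 ≤ h r) (h0 : h 0 = 0) (hC : ∀ r, |deriv h r| ≤ C * (1 + |r|)) :
    IsQuadConvex h where
  convex := hc
  nonneg := hn
  map_zero := h0
  growth := by
    refine ⟨2 * C, fun r => ?_⟩
    have h1 := hc.add_deriv_mul_le (hd r).hasDerivAt 0
    have h2 : deriv h r * r ≤ C * (1 + |r|) * |r| :=
      (le_abs_self _).trans (by rw [abs_mul]; gcongr; exact hC r)
    have hC0 : 0 ≤ C := by simpa using (abs_nonneg _).trans (hC 0)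
    have h3 : C * (1 + |r|) * |r| ≤ 2 * C * (1 + r ^ 2) := by
      rw [← sq_abs r]
      have : (1 + |r|) * |r| ≤ 2 * (1 + |r| ^ 2) := by nlinarith [sq_nonneg (|r| - 1)]
      nlinarith
    linarith

end IsQuadConvex

/-- A subgradient of an integral functional is a pointwise subgradient. -/
lemma ae_subgradient_of_integral {h : ℝ → ℝ → ℝ} {w p : X L}
    (hcont : ∀ x, Continuous (h x))
    (hint : ∀ q : X L, Integrable (fun x => h x (q x)) (omegaMeasure L))
    (H : ∀ q : X L, (∫ x in Ioo (-L) L, h x (p x)) + ∫ x in Ioo (-L) L, w x * (q x - p x) ≤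
      ∫ x in Ioo (-L) L, h x (q x)) :
    ∀ᵐ x ∂(omegaMeasure L), ∀ r, h x (p x) + w x * (r - p x) ≤ h x r := by
  have hwq : ∀ q : X L, Integrable (fun x => w x * (q x - p x)) (omegaMeasure L) := by
    intro q
    refine ((X.integrable_mul w q).sub (X.integrable_mul w p)).congr
      (Eventually.of_forall fun x => ?_)
    simp only [Pi.sub_apply]; ring
  have key : ∀ r : ℝ, ∀ᵐ x ∂(omegaMeasure L),
      0 ≤ h x r - h x (p x) - w x * (r - p x) := by
    intro r
    have hrm : MemLp (fun _ : ℝ => r) 2 (omegaMeasure L) := memLp_const r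
    have hr : (hrm.toLp _ : X L) =ᵐ[omegaMeasure L] fun _ => r := hrm.coeFn_toLp
    have hI : ∀ q : X L, Integrable (fun x => h x (q x) - h x (p x) - w x * (q x - p x))
        (omegaMeasure L) := fun q => ((hint q).sub (hint p)).sub (hwq q)
    have hIr : Integrable (fun x => h x r - h x (p x) - w x * (r - p x)) (omegaMeasure L) := by
      refine (hI (hrm.toLp _)).congr ?_
      filter_upwards [hr] with x hx
      rw [hx]
    refine ae_nonneg_of_forall_setIntegral_nonneg hIr fun s hs _ => ?_
    classical
    -- The competitor equal to `r` on `s` and to `p` elsewhere localizes the inequality to `s`.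
    have hqm : MemLp (s.piecewise (fun _ => r) p) 2 (omegaMeasure L) :=
      MemLp.piecewise hs (memLp_const r) ((Lp.memLp p).restrict _)
    have hq := hqm.coeFn_toLp
    have h1 := H (hqm.toLp _)
    have h2 : 0 ≤ ∫ x in Ioo (-L) L, (h x (hqm.toLp _ x) - h x (p x) -
        w x * (hqm.toLp _ x - p x)) := by
      have hA : Integrable (fun x => h x (hqm.toLp _ x) - h x (p x)) (omegaMeasure L) :=
        (hint _).sub (hint p)
      rw [integral_sub hA (hwq _), integral_sub (hint _) (hint p)]
      linarith
    rw [← integral_indicator hs]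
    refine h2.trans_eq (integral_congr_ae ?_)
    filter_upwards [hq] with x hx
    rw [hx]
    by_cases hxs : x ∈ s
    · simp [hxs]
    · simp [hxs]
  -- Rational `r` give one null set for all; continuity then covers real `r`.
  have key' : ∀ᵐ x ∂(omegaMeasure L), ∀ r : ℚ,
      0 ≤ h x r - h x (p x) - w x * (r - p x) := ae_all_iff.2 fun r => key r
  filter_upwards [key'] with x hx r
  have hcl : IsClosed {r : ℝ | 0 ≤ h x r - h x (p x) - w x * (r - p x)} :=
    isClosed_le continuous_const
      (((hcont x).sub continuous_const).sub
        (continuous_const.mul (continuous_id.sub continuous_const)))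
  have hd : ∀ r : ℝ, 0 ≤ h x r - h x (p x) - w x * (r - p x) := fun r =>
    (Rat.denseRange_cast (𝕜 := ℝ)).induction_on
      (p := fun r : ℝ => 0 ≤ h x r - h x (p x) - w x * (r - p x)) r hcl hx
  linarith [hd r]

lemma IsAbsRegularization.isQuadConvex {f : ℝ → ℝ → ℝ} (hf : IsAbsRegularization f) {ε : ℝ}
    (hε : ε ∈ Icc (0 : ℝ) 1) : IsQuadConvex (f ε) := by
  rcases eq_or_lt_of_le hε.1 with rfl | h0
  · have : f 0 = fun r => |r| := funext hf.zero_param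
    rw [this]
    refine ⟨convexOn_univ_norm, abs_nonneg, abs_zero, 1, fun r => ?_⟩
    rw [← sq_abs]
    nlinarith [sq_nonneg (|r| - 1)]
  · have hm : ε ∈ Ioc (0 : ℝ) 1 := ⟨h0, hε.2⟩
    obtain ⟨C, _, hC⟩ := hf.deriv_growth
    exact IsQuadConvex.of_deriv (hf.convex ε hm) ((hf.contDiff ε hm).differentiable (by norm_num))
      (hf.nonneg ε hm) (hf.map_zero ε hm) (hC ε hm)

/-- `Khat δ` vanishes near `0`, so by convexity `0` is a minimum; the bound on the second derivative
makes the first one grow at most linearly. -/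
lemma IsIndicatorRegularization.isQuadConvex {Khat : ℝ → ℝ → ℝ}
    (hK : IsIndicatorRegularization Khat) {δ : ℝ} (hδ : δ ∈ Ioc (0 : ℝ) 1) :
    IsQuadConvex (Khat δ) := by
  have hcd := hK.contDiff δ hδ
  have hd : Differentiable ℝ (Khat δ) := hcd.differentiable (by norm_num)
  have hd' : Differentiable ℝ (deriv (Khat δ)) :=
    ((contDiff_succ_iff_deriv (n := 1)).1 hcd).2.2.differentiable (by norm_num)
  obtain ⟨C, hC0, hC⟩ := hK.deriv_two_bound δ hδ
  have hconv : ConvexOn ℝ univ (Khat δ) :=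
    convexOn_univ_of_deriv2_nonneg hd hd' fun x => (hC x).1
  have h0 : Khat δ 0 = 0 := hK.eq_zero δ hδ 0 (by norm_num)
  have hd0 : deriv (Khat δ) 0 = 0 := by
    have : Khat δ =ᶠ[𝓝 0] fun _ => 0 := by
      filter_upwards [Icc_mem_nhds (show (-1 : ℝ) < 0 by norm_num) (show (0 : ℝ) < 1 by norm_num)]
        with r hr using hK.eq_zero δ hδ r hr
    rw [this.deriv_eq, deriv_const]
  refine IsQuadConvex.of_deriv (C := C) hconv hd (fun r => ?_) h0 fun r => ?_
  · have := hconv.add_deriv_mul_le (hd 0).hasDerivAt r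
    rw [hd0, h0] at this
    linarith
  · have := convex_univ.norm_image_sub_le_of_norm_deriv_le (f := deriv (Khat δ)) (C := C)
      (fun x _ => hd' x) (fun x _ => by rw [Real.norm_of_nonneg (hC x).1]; exact (hC x).2)
      (mem_univ 0) (mem_univ r)
    simp only [hd0, sub_zero, Real.norm_eq_abs] at this
    nlinarith [abs_nonneg r]

/-! ### The total variation of a Sobolev function -/

lemma exists_smooth_cutoff (hL : 0 < L) (p : X L) {η : ℝ} (hη : 0 < η) :
    ∃ χ : ℝ → ℝ, ContDiff ℝ ∞ χ ∧ HasCompactSupport χ ∧ tsupport χ ⊆ Ioo (-L) L ∧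
      (∀ x, 0 ≤ χ x) ∧ (∀ x, χ x ≤ 1) ∧
      (∫ x in Ioo (-L) L, |p x|) - η < ∫ x in Ioo (-L) L, χ x * |p x| := by
  -- Inner and outer radii of bumps whose plateaus exhaust `Ω`: `a n < b n < L` and `a n → L`.
  let a : ℕ → ℝ := fun n => L * (1 - 1 / ((n : ℝ) + 2))
  let b : ℕ → ℝ := fun n => L * (1 - 1 / ((n : ℝ) + 3))
  have ha : ∀ n, 0 < a n := fun n => by
    have : 1 / ((n : ℝ) + 2) < 1 := by
      rw [div_lt_one (by positivity)]
      linarith [n.cast_nonneg (α := ℝ)]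
    exact mul_pos hL (by linarith)
  have hab : ∀ n, a n < b n := fun n => by
    have : 1 / ((n : ℝ) + 3) < 1 / ((n : ℝ) + 2) :=
      one_div_lt_one_div_of_lt (by positivity) (by linarith)
    exact mul_lt_mul_of_pos_left (by linarith) hL
  have hb : ∀ n, b n < L := fun n => by
    have : 0 < 1 / ((n : ℝ) + 3) := by positivity
    have := mul_lt_mul_of_pos_left (show 1 - 1 / ((n : ℝ) + 3) < 1 by linarith) hL
    simpa [b] using this
  let B : ℕ → ContDiffBump (0 : ℝ) := fun n => ⟨a n, b n, ha n, hab n⟩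
  have hlim : Tendsto a atTop (𝓝 L) := by
    have h1 : Tendsto (fun n : ℕ => 1 / ((n : ℝ) + 2)) atTop (𝓝 0) := by
      have := tendsto_const_div_atTop_nhds_zero_nat (1 : ℝ)
      have h2 := (tendsto_add_atTop_iff_nat 2).2 this
      simpa using h2
    simpa [a] using (tendsto_const_nhds (x := L)).mul ((tendsto_const_nhds (x := (1 : ℝ))).sub h1)
  have hT : Tendsto (fun n => ∫ x in Ioo (-L) L, B n x * |p x|) atTop
      (𝓝 (∫ x in Ioo (-L) L, |p x|)) := by
    refine tendsto_integral_of_dominated_convergence (fun x => |p x|)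
      (fun n => ((B n).continuous.aestronglyMeasurable).mul
        (Lp.aestronglyMeasurable p).norm) p.integrable.abs (fun n => ?_) ?_
    · refine Eventually.of_forall fun x => ?_
      rw [norm_mul, Real.norm_of_nonneg (B n).nonneg, Real.norm_of_nonneg (abs_nonneg _)]
      exact mul_le_of_le_one_left (abs_nonneg _) (B n).le_one
    · filter_upwards [ae_restrict_mem measurableSet_Ioo] with x hx
      refine tendsto_const_nhds.congr' ?_
      have hxL : |x| < L := abs_lt.2 hx
      filter_upwards [hlim.eventually (lt_mem_nhds hxL)] with n hn
      have : B n x = 1 := (B n).one_of_mem_closedBall (by simpa using hn.le)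
      rw [this, one_mul]
  obtain ⟨n, hn⟩ := (hT.eventually (lt_mem_nhds (sub_lt_self _ hη))).exists
  refine ⟨B n, (B n).contDiff, (B n).hasCompactSupport, ?_, fun x => (B n).nonneg,
    fun x => (B n).le_one, hn⟩
  rw [(B n).tsupport_eq, Real.closedBall_eq_Icc]
  intro x hx
  have := hb n
  have h1 := hx.1
  have h2 := hx.2
  simp only [B] at h1 h2
  exact ⟨by linarith, by linarith⟩

/-- `g / √(g² + m²)` is a smooth substitute for the sign of `g`; pairing it with `g` loses at most
`m`. -/
lemma sub_le_sq_div_sqrt {g m : ℝ} (hm : 0 < m) : |g| - m ≤ g ^ 2 / √(g ^ 2 + m ^ 2) := by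
  have hs : 0 < √(g ^ 2 + m ^ 2) := Real.sqrt_pos.2 (by positivity)
  have hle : √(g ^ 2 + m ^ 2) ≤ |g| + m :=
    Real.sqrt_le_iff.2 ⟨by positivity, by nlinarith [abs_nonneg g, sq_abs g]⟩
  rw [le_div_iff₀ hs]
  rcases le_total |g| m with h | h
  · nlinarith [sq_nonneg g]
  · nlinarith [sq_abs g, sq_nonneg m]

lemma abs_div_sqrt_le_one {g m : ℝ} (hm : 0 < m) : |g / √(g ^ 2 + m ^ 2)| ≤ 1 := by
  have hs : 0 < √(g ^ 2 + m ^ 2) := Real.sqrt_pos.2 (by positivity)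
  rw [abs_div, abs_of_pos hs, div_le_one hs]
  exact Real.abs_le_sqrt (by nlinarith [sq_nonneg m])

/-- Cut-off times smoothed sign of a smooth `L¹`-approximation of `p`: this yields nearly optimal
test functions for the total variation. -/
lemma exists_smooth_approx_sign (hL : 0 < L) (p : X L) {η : ℝ} (hη : 0 < η) :
    ∃ ψ : ℝ → ℝ, ContDiff ℝ ∞ ψ ∧ HasCompactSupport ψ ∧ tsupport ψ ⊆ Ioo (-L) L ∧
      (∀ x, |ψ x| ≤ 1) ∧
      (∫ x in Ioo (-L) L, |p x|) - η < ∫ x in Ioo (-L) L, p x * ψ x := by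
  obtain ⟨χ, hχ1, hχ2, hχ3, hχ4, hχ5, hχ6⟩ :=
    exists_smooth_cutoff hL p (show 0 < η / 4 by positivity)
  obtain ⟨g, hg1, hg2, hg3⟩ := MemLp.exist_eLpNorm_sub_le (p := 1) (by simp) le_rfl
    (memLp_one_iff_integrable.2 p.integrable) (show 0 < η / 4 by positivity)
  -- Error budget: `η/4` for the cut-off, twice `η/4` for replacing `p` by `g`, and `2 L m = η/4`
  -- for the smoothed sign. Strictness comes from the cut-off.
  set m := η / (8 * L) with hm
  have hm0 : 0 < m := by positivity
  have hgi : Integrable g (omegaMeasure L) :=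
    (hg2.continuous.integrable_of_hasCompactSupport hg1).integrableOn
  have hpg : ∫ x in Ioo (-L) L, |p x - g x| ≤ η / 4 := by
    rw [eLpNorm_one_eq_lintegral_enorm] at hg3
    have h1 := integral_norm_eq_lintegral_enorm (μ := omegaMeasure L) (f := fun x => p x - g x)
      (p.integrable.sub hgi).aestronglyMeasurable
    simp only [Real.norm_eq_abs] at h1
    rw [h1]
    exact ENNReal.toReal_le_of_le_ofReal (by positivity) hg3
  let ψ : ℝ → ℝ := fun x => χ x * (g x / √(g x ^ 2 + m ^ 2))
  have hsq : ∀ x, g x ^ 2 + m ^ 2 ≠ 0 := fun x => by positivity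
  have hψ1 : ContDiff ℝ ∞ ψ := hχ1.mul (hg2.div
    (((hg2.pow 2).add contDiff_const).sqrt hsq) fun x => (Real.sqrt_pos.2 (by positivity)).ne')
  have hψle : ∀ x, |ψ x| ≤ 1 := fun x => by
    simp only [ψ]
    rw [abs_mul, abs_of_nonneg (hχ4 x)]
    exact mul_le_one₀ (hχ5 x) (abs_nonneg _) (abs_div_sqrt_le_one hm0)
  have hts : tsupport ψ ⊆ tsupport χ := tsupport_mul_subset_left
  refine ⟨ψ, hψ1, hχ2.mul_right, hts.trans hχ3, hψle, ?_⟩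
  have hpt : ∀ x, χ x * |p x| - 2 * |p x - g x| - m ≤ p x * ψ x := by
    intro x
    have e1 : g x * ψ x = χ x * (g x ^ 2 / √(g x ^ 2 + m ^ 2)) := by simp only [ψ]; ring
    have e2 := mul_le_mul_of_nonneg_left (sub_le_sq_div_sqrt (g := g x) hm0) (hχ4 x)
    have e3 : -|p x - g x| ≤ (p x - g x) * ψ x := by
      have := abs_le.1 (show |(p x - g x) * ψ x| ≤ |p x - g x| by
        rw [abs_mul]; exact mul_le_of_le_one_right (abs_nonneg _) (hψle x))
      exact this.1
    have e4 : |p x| ≤ |g x| + |p x - g x| := by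
      have := abs_add_le (g x) (p x - g x)
      simpa using this
    have e5 : χ x * |p x| ≤ χ x * |g x| + |p x - g x| := by
      nlinarith [hχ4 x, hχ5 x, abs_nonneg (p x - g x)]
    have e6 : χ x * m ≤ m := mul_le_of_le_one_left hm0.le (hχ5 x)
    nlinarith
  have hi1 : Integrable (fun x => χ x * |p x|) (omegaMeasure L) :=
    (integrable_mul_of_compactSupport p hχ1.continuous hχ2).abs.congr
      (Eventually.of_forall fun x => by simp [abs_mul, abs_of_nonneg (hχ4 x), mul_comm])
  have hi2 : Integrable (fun x => 2 * |p x - g x|) (omegaMeasure L) :=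
    (p.integrable.sub hgi).abs.const_mul 2
  have hi3 : Integrable (fun x => χ x * |p x| - 2 * |p x - g x|) (omegaMeasure L) := hi1.sub hi2
  have hmono : ∫ x in Ioo (-L) L, (χ x * |p x| - 2 * |p x - g x| - m) ≤
      ∫ x in Ioo (-L) L, p x * ψ x := integral_mono (hi3.sub (integrable_const m))
    (integrable_mul_of_compactSupport p hψ1.continuous hχ2.mul_right) hpt
  rw [integral_sub hi3 (integrable_const m), integral_sub hi1 hi2, integral_const_mul,
    integral_const] at hmono
  have hvol : (omegaMeasure L).real univ = 2 * L := by
    rw [measureReal_restrict_apply_univ, Real.volume_real_Ioo_of_le (by linarith)]; ring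
  rw [hvol, smul_eq_mul] at hmono
  have hmL : 2 * L * m = η / 4 := by rw [hm]; field_simp; ring
  linarith

lemma IsRep.eq_of_ae_eq {u c : ℝ → ℝ} {z g : X L} (hL : 0 < L) (h : IsRep u z g)
    (hc : ContinuousOn c (Icc (-L) L)) (hz : ∀ᵐ x ∂(omegaMeasure L), z x = c x) :
    EqOn u c (Icc (-L) L) := by
  refine Measure.eqOn_Icc_of_ae_eq volume (by linarith) ?_ (h.continuousOn hL) hc
  rw [← restrict_Ioo_eq_restrict_Icc]
  filter_upwards [h.ae_eq, hz] with x h1 h2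
  rw [← h1, h2]

lemma exists_isRep_of_contDiff (hL : 0 < L) {ψ : ℝ → ℝ} (hψ : ContDiff ℝ ∞ ψ) :
    ∃ z g : X L, IsRep ψ z g := by
  have hac : AbsolutelyContinuousOnInterval ψ (-L) L :=
    ((hψ.of_le (by norm_num)).contDiffOn).absolutelyContinuousOnInterval
  have hd : ContDiff ℝ ∞ (deriv ψ) := (contDiff_infty_iff_deriv.1 hψ).2
  have hac' : AbsolutelyContinuousOnInterval (deriv ψ) (-L) L :=
    ((hd.of_le (by norm_num)).contDiffOn).absolutelyContinuousOnInterval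
  have hm := memLp_of_ac hL hac' 2
  obtain ⟨z, hz⟩ := exists_isRep_of_ac hL hac (g := hm.toLp _) (by
    filter_upwards [hm.coeFn_toLp] with x hx
    rw [hx]
    exact (hψ.differentiable (by norm_num) x).hasDerivAt)
  exact ⟨z, _, hz⟩

/-- Integration by parts has no boundary terms, since test functions vanish at `±L`. The upper bound
then uses `|φ| ≤ 1`, the lower one smooth approximations of the negative sign of `∂ₓz`. -/
lemma totalVariation_eq (hL : 0 < L) {z : X L} (hz : z ∈ H1 L) :
    totalVariation z = ((∫ x in Ioo (-L) L, |weakDeriv z x| : ℝ) : EReal) := by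
  obtain ⟨u, hu⟩ := exists_isRep_of_mem_H1 hL hz
  apply le_antisymm
  · refine sSup_le ?_
    rintro _ ⟨φ, c, hφ, hφc, hc, _, hcs, hc1, rfl⟩
    obtain ⟨v, hv⟩ := exists_isRep_of_mem_H1 hL hφ
    have heq := hv.eq_of_ae_eq hL hc.continuousOn hφc
    rw [EReal.coe_le_coe_iff, hu.integral_mul hL hv, heq (left_mem_Icc.2 (by linarith)),
      heq (right_mem_Icc.2 (by linarith)), eq_zero_of_tsupport_subset (x := L) hcs (by simp),
      eq_zero_of_tsupport_subset (x := -L) hcs (by simp), mul_zero, mul_zero, sub_zero, zero_sub,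
      ← integral_neg]
    refine integral_mono_ae (X.integrable_mul _ _).neg (X.integrable _).abs ?_
    filter_upwards [hφc, ae_restrict_mem measurableSet_Ioo] with x hx hx'
    have h1 := hc1 x (Ioo_subset_Icc_self hx')
    rw [hx]
    calc -(weakDeriv z x * c x) ≤ |weakDeriv z x * c x| := neg_le_abs _
      _ ≤ |weakDeriv z x| := by
        rw [abs_mul]; exact mul_le_of_le_one_right (abs_nonneg _) h1
  · by_contra! hlt
    obtain ⟨r, hr1, hr2⟩ := EReal.lt_iff_exists_real_btwn.1 hlt
    rw [EReal.coe_lt_coe_iff] at hr2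
    obtain ⟨ψ, h1, h2, h3, h4, h5⟩ :=
      exists_smooth_approx_sign hL (weakDeriv z) (sub_pos.2 hr2)
    obtain ⟨φ, g, hφ⟩ := exists_isRep_of_contDiff hL h1.neg
    have hmem : ((∫ x in Ioo (-L) L, z x * weakDeriv φ x : ℝ) : EReal) ≤ totalVariation z := by
      refine le_sSup ⟨φ, _, hφ.mem_H1 hL, hφ.ae_eq, h1.neg.continuous, h2.neg, ?_, ?_, rfl⟩
      · rw [show tsupport (fun x => -ψ x) = tsupport ψ from tsupport_fun_neg ψ]; exact h3
      · intro x _; rw [abs_neg]; exact h4 x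
    have hlt' := hmem.trans_lt hr1
    rw [EReal.coe_lt_coe_iff, hφ.weakDeriv_eq hL, hu.integral_mul hL hφ,
      eq_zero_of_tsupport_subset (x := L) h3 (by simp),
      eq_zero_of_tsupport_subset (x := -L) h3 (by simp)] at hlt'
    have h6 : ∫ x in Ioo (-L) L, weakDeriv z x * φ x =
        -∫ x in Ioo (-L) L, weakDeriv z x * ψ x := by
      rw [← integral_neg]
      refine integral_congr_ae ?_
      filter_upwards [hφ.ae_eq] with x hx
      rw [hx]; ring
    rw [h6] at hlt'
    linarith

/-! ### The sum rule for subdifferentials -/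

/-- The Moreau-Rockafellar sum rule, for the sum of a convex function on a convex set and a
continuous convex function. -/
theorem exists_subgradient_of_add {E : Type*} [NormedAddCommGroup E] [InnerProductSpace ℝ E]
    [CompleteSpace E] {D : Set E} {F J : E → ℝ} (hF : ConvexOn ℝ D F) (hJ : ConvexOn ℝ univ J)
    (hJc : Continuous J) {z ζ : E} (hz : z ∈ D)
    (H : ∀ y ∈ D, F z + J z + inner ℝ ζ (y - z) ≤ F y + J y) :
    ∃ ξ : E, (∀ y, J z + inner ℝ ξ (y - z) ≤ J y) ∧
      ∀ y ∈ D, F z + inner ℝ (ζ - ξ) (y - z) ≤ F y := by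
  -- By `H`, the concave `G` lies below `J` on `D` and touches it at `z`; a hyperplane between
  -- hypograph and open strict epigraph has slope `ξ`.
  let G : E → ℝ := fun y => F z + J z + inner ℝ ζ (y - z) - F y
  have hG : ConcaveOn ℝ D G := by
    refine ConcaveOn.sub ⟨hF.1, fun x _ y _ a b _ _ hab => le_of_eq ?_⟩ hF
    obtain rfl : b = 1 - a := by linarith
    simp only [inner_sub_right, inner_add_right, inner_smul_right, smul_eq_mul]
    ring
  let A : Set (E × ℝ) := {p | p.1 ∈ univ ∧ J p.1 < p.2}
  let B : Set (E × ℝ) := {p | p.1 ∈ D ∧ p.2 ≤ G p.1}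
  have hAo : IsOpen A := by
    have : A = {p | J p.1 < p.2} := by ext p; simp [A]
    rw [this]
    exact isOpen_lt (hJc.comp continuous_fst) continuous_snd
  have hdisj : Disjoint A B := by
    rw [Set.disjoint_left]
    rintro ⟨y, t⟩ ⟨_, h1⟩ ⟨h2, h3⟩
    have := H y h2
    simp only [G] at h1 h3
    linarith
  obtain ⟨f, u, hfA, hfB⟩ := geometric_hahn_banach_open hJ.convex_strict_epigraph hAo
    hG.convex_hypograph hdisj
  let φ : StrongDual ℝ E := f.comp (ContinuousLinearMap.inl ℝ E ℝ)
  set s : ℝ := f (0, 1) with hs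
  have hf : ∀ y t, f (y, t) = φ y + t * s := by
    intro y t
    have : ((y, t) : E × ℝ) = (y, 0) + t • (0, 1) := by simp
    rw [this, map_add, map_smul, smul_eq_mul]
    rfl
  have hA' : ∀ y t, J y < t → φ y + t * s < u := fun y t h => by
    rw [← hf]; exact hfA (y, t) ⟨mem_univ _, h⟩
  have hB' : ∀ y ∈ D, u ≤ φ y + G y * s := fun y h => by
    rw [← hf]; exact hfB (y, G y) ⟨h, le_rfl⟩
  have hGz : G z = J z := by simp [G]
  have hBz := hB' z hz
  rw [hGz] at hBz
  -- The hyperplane is not vertical, because `z` lies in the domain of both functions.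
  have hs0 : s < 0 := by
    have := hA' z (J z + 1) (by linarith)
    linarith
  have hA'' : ∀ y, φ y + J y * s ≤ u := by
    intro y
    have hT : Tendsto (fun t : ℝ => φ y + t * s) (𝓝[>] (J y)) (𝓝 (φ y + J y * s)) :=
      (Continuous.tendsto (by fun_prop) _).mono_left nhdsWithin_le_nhds
    exact le_of_tendsto hT (eventually_nhdsWithin_of_forall fun t ht => (hA' y t ht).le)
  let ξ : E := (-s)⁻¹ • (InnerProductSpace.toDual ℝ E).symm φ
  have hξ : ∀ v, inner ℝ ξ v * (-s) = φ v := by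
    intro v
    simp only [ξ, real_inner_smul_left, InnerProductSpace.toDual_symm_apply]
    have := hs0.ne
    field_simp
  refine ⟨ξ, fun y => ?_, fun y hy => ?_⟩
  · have h1 := hA'' y
    have h2 := hξ (y - z)
    rw [map_sub] at h2
    have : (J z + inner ℝ ξ (y - z)) * (-s) ≤ J y * (-s) := by linarith
    exact le_of_mul_le_mul_right this (by linarith)
  · have h1 := hB' y hy
    have h1' := hA'' z
    have h2 := hξ (y - z)
    rw [map_sub] at h2
    have : (F z + inner ℝ (ζ - ξ) (y - z)) * (-s) ≤ F y * (-s) := by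
      rw [inner_sub_left]
      simp only [G] at h1
      linarith
    exact le_of_mul_le_mul_right this (by linarith)

/-! ### The subdifferential of the gradient energy -/

/-- Testing at `p + t (r - p)` and dividing by `t` leaves the quadratic remainder with a factor `t`,
which disappears as `t → 0`. -/
lemma subgradient_sub_sq {h : ℝ → ℝ} (hh : ConvexOn ℝ univ h) {ν p w : ℝ}
    (H : ∀ r, (h p + ν ^ 2 / 2 * p ^ 2) + w * (r - p) ≤ h r + ν ^ 2 / 2 * r ^ 2) (r : ℝ) :
    h p + (w - ν ^ 2 * p) * (r - p) ≤ h r := by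
  have key : ∀ t ∈ Ioc (0 : ℝ) 1,
      h p + (w - ν ^ 2 * p) * (r - p) - ν ^ 2 / 2 * (r - p) ^ 2 * t ≤ h r := by
    intro t ht
    have h1 := H (p + t * (r - p))
    have h2 := hh.2 (mem_univ p) (mem_univ r) (sub_nonneg.2 ht.2) ht.1.le (by ring)
    simp only [smul_eq_mul] at h2
    rw [show (1 - t) * p + t * r = p + t * (r - p) by ring] at h2
    have h3 : (h p + (w - ν ^ 2 * p) * (r - p) - ν ^ 2 / 2 * (r - p) ^ 2 * t) * t ≤ h r * t := by
      nlinarith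
    exact le_of_mul_le_mul_right h3 ht.1
  have hT : Tendsto (fun t : ℝ => h p + (w - ν ^ 2 * p) * (r - p) - ν ^ 2 / 2 * (r - p) ^ 2 * t)
      (𝓝[>] 0) (𝓝 (h p + (w - ν ^ 2 * p) * (r - p) - ν ^ 2 / 2 * (r - p) ^ 2 * 0)) :=
    (Continuous.tendsto (by fun_prop) _).mono_left nhdsWithin_le_nhds
  have := le_of_tendsto hT (by
    filter_upwards [Ioc_mem_nhdsGT (show (0 : ℝ) < 1 by norm_num)] with t ht using key t ht)
  linarith

/-- Adding the two inequalities gives `ν² (p - q)² ≤ (v - w)(p - q)`: the inverse of `∂h + ν²` is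
Lipschitz. -/
lemma abs_sub_le_of_subgradients {h : ℝ → ℝ} {ν p q v w : ℝ} (hν : 0 < ν)
    (hp : ∀ r, h p + (v - ν ^ 2 * p) * (r - p) ≤ h r)
    (hq : ∀ r, h q + (w - ν ^ 2 * q) * (r - q) ≤ h r) :
    |p - q| ≤ (ν ^ 2)⁻¹ * |v - w| := by
  have h1 := hp q
  have h2 := hq p
  have hν2 : 0 < ν ^ 2 := by positivity
  have h3 : ν ^ 2 * |p - q| ^ 2 ≤ |v - w| * |p - q| := by
    rw [← abs_mul, sq_abs]
    exact le_trans (by nlinarith) (le_abs_self ((v - w) * (p - q)))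
  rw [inv_mul_eq_div, le_div_iff₀ hν2]
  by_contra! hlt
  have h0 : 0 < |p - q| := by
    by_contra! h'
    have : |p - q| = 0 := le_antisymm h' (abs_nonneg _)
    rw [this] at hlt
    linarith [abs_nonneg (v - w)]
  nlinarith

lemma integrable_mul_sub (w p q : X L) :
    Integrable (fun x => w x * (q x - p x)) (omegaMeasure L) :=
  ((X.integrable_mul w q).sub (X.integrable_mul w p)).congr
    (Eventually.of_forall fun x => by simp only [Pi.sub_apply]; ring)

lemma X.inner_sub_eq (g y z : X L) :
    (inner ℝ g (y - z) : ℝ) = ∫ x in Ioo (-L) L, g x * (y x - z x) := by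
  rw [X.inner_eq]
  refine integral_congr_ae ?_
  filter_upwards [Lp.coeFn_sub y z] with x hx
  rw [hx, Pi.sub_apply]

/-- Euler-Lagrange equation of the gradient energy, integrated once. -/
lemma exists_flux_of_subgradient (hL : 0 < L) {g : ℝ → ℝ} (hg : IsQuadConvex g) {z ζ : X L}
    (hz : z ∈ H1 L)
    (H : ∀ y ∈ H1 L, (∫ x in Ioo (-L) L, g (weakDeriv z x)) + inner ℝ ζ (y - z) ≤
      ∫ x in Ioo (-L) L, g (weakDeriv y x)) :
    ∃ (u : ℝ → ℝ) (W : X L), IsRep u W (-ζ) ∧ u (-L) = 0 ∧ u L = 0 ∧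
      ∀ᵐ x ∂(omegaMeasure L), ∀ r,
        g (weakDeriv z x) + W x * (r - weakDeriv z x) ≤ g r := by
  obtain ⟨v, hv⟩ := exists_isRep_of_mem_H1 hL hz
  obtain ⟨W, hW⟩ := exists_isRep_primitive hL 0 (-ζ)
  set u := primitive 0 (-ζ)
  have hu0 : u (-L) = 0 := by simp [u, primitive]
  -- The competitor adds to `z` the primitive of an arbitrary `q ∈ L²` with arbitrary value `c` at
  -- `-L`.
  have hpert : ∀ (c : ℝ) (q : X L), (∫ x in Ioo (-L) L, g (weakDeriv z x)) -
      (u L * primitive c q L - ∫ x in Ioo (-L) L, W x * q x) ≤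
      ∫ x in Ioo (-L) L, g ((weakDeriv z + q : X L) x) := by
    intro c q
    obtain ⟨k, hk⟩ := exists_isRep_primitive hL c q
    have hsum := hv.add hk
    have h1 := H (z + k) (hsum.mem_H1 hL)
    rw [hsum.weakDeriv_eq hL, add_sub_cancel_left, X.inner_eq] at h1
    have h2 := hW.integral_mul hL hk
    rw [hu0, zero_mul, sub_zero] at h2
    have h3 : ∫ x in Ioo (-L) L, (-ζ : X L) x * k x = -∫ x in Ioo (-L) L, ζ x * k x := by
      rw [← integral_neg]
      refine integral_congr_ae ?_
      filter_upwards [Lp.coeFn_neg ζ] with x hx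
      rw [hx, Pi.neg_apply]; ring
    rw [h3] at h2
    linarith
  have huL : u L = 0 := by
    have h0 : ∫ x in Ioo (-L) L, W x * (0 : X L) x = 0 := by
      rw [← X.inner_eq, inner_zero_right]
    -- Perturbation by the constants `-1` and `1`; the subtracted integral cancels the one inside
    -- `primitive`.
    have h1 := hpert (-1 - ∫ t in (-L)..L, (0 : X L) t) 0
    have h2 := hpert (1 - ∫ t in (-L)..L, (0 : X L) t) 0
    simp only [primitive, add_zero, h0, sub_add_cancel] at h1 h2
    linarith
  refine ⟨u, W, hW, hu0, huL, ae_subgradient_of_integral (h := fun _ => g)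
    (fun _ => hg.continuous) (fun q => hg.integrable q) fun q => ?_⟩
  have h1 := hpert 0 (q - weakDeriv z)
  rw [huL, zero_mul, zero_sub, sub_neg_eq_add, ← X.inner_eq, X.inner_sub_eq,
    add_sub_cancel] at h1
  exact h1

/-- The subgradients of the gradient energy: regularity and the decomposition of the flux. -/
lemma exists_decomposition_of_subgradient (hL : 0 < L) {h : ℝ → ℝ} (hh : IsQuadConvex h) {ν : ℝ}
    (hν : 0 < ν) {z ζ : X L} (hz : z ∈ H1 L)
    (H : ∀ y ∈ H1 L,
      (∫ x in Ioo (-L) L, (h (weakDeriv z x) + ν ^ 2 / 2 * weakDeriv z x ^ 2)) +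
        inner ℝ ζ (y - z) ≤
      ∫ x in Ioo (-L) L, (h (weakDeriv y x) + ν ^ 2 / 2 * weakDeriv y x ^ 2)) :
    z ∈ H2 L ∧ ∃ ϖ : X L, ϖ ∈ H1 L ∧ MemLp ϖ ⊤ (omegaMeasure L) ∧
      VanishesAtBoundary (ϖ + ν ^ 2 • weakDeriv z) ∧
      (∀ᵐ x ∂(omegaMeasure L),
        ϖ x ∈ subdifferential (fun r : ℝ => ((h r : ℝ) : EReal)) (weakDeriv z x)) ∧
      ζ = -weakDeriv ϖ - ν ^ 2 • weakDeriv (weakDeriv z) := by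
  obtain ⟨u, W, hW, hu0, huL, hsub⟩ := exists_flux_of_subgradient hL (hh.add_sq ν) hz H
  set p := weakDeriv z
  have hsub' : ∀ᵐ x ∂(omegaMeasure L), ∀ r, h (p x) + (u x - ν ^ 2 * p x) * (r - p x) ≤ h r := by
    filter_upwards [hsub, hW.ae_eq] with x h1 h2
    rw [← h2]
    exact subgradient_sub_sq hh.convex h1
  -- On this set of full measure `p x` depends only on `u x`, and in a Lipschitz way; the chosen
  -- preimage in `S₀` is therefore irrelevant. Extending `S₀` to `ℝ` and composing with `u` gives `p
  -- ∈ H¹`.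
  let A : Set ℝ := {x | ∀ r, h (p x) + (u x - ν ^ 2 * p x) * (r - p x) ≤ h r}
  let S₀ : ℝ → ℝ := fun v => p (Function.invFunOn u A v)
  let K : NNReal := ⟨(ν ^ 2)⁻¹, by positivity⟩
  have hinv : ∀ v ∈ u '' A, Function.invFunOn u A v ∈ A ∧ u (Function.invFunOn u A v) = v :=
    fun v hv => ⟨Function.invFunOn_mem hv, Function.invFunOn_eq hv⟩
  have hS₀ : LipschitzOnWith K S₀ (u '' A) := by
    refine LipschitzOnWith.of_dist_le_mul fun v hv w hw => ?_
    have h1 := abs_sub_le_of_subgradients hν (hinv v hv).1 (hinv w hw).1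
    rw [(hinv v hv).2, (hinv w hw).2] at h1
    exact h1
  have hS₀eq : ∀ x ∈ A, S₀ (u x) = p x := by
    intro x hx
    have h1 := hinv (u x) (mem_image_of_mem u hx)
    have h2 := abs_sub_le_of_subgradients hν h1.1 hx
    rw [h1.2, sub_self, abs_zero, mul_zero] at h2
    exact sub_eq_zero.1 (abs_eq_zero.1 (le_antisymm h2 (abs_nonneg _)))
  obtain ⟨S, hS, hSeq⟩ := hS₀.extend_real
  obtain ⟨p', dp, hp'⟩ := hW.exists_lipschitz_comp hL hS
  have hpp' : p' = p := by
    refine Lp.ext ?_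
    filter_upwards [hp'.ae_eq, hsub'] with x h1 h2
    rw [h1, ← hSeq (mem_image_of_mem u h2), hS₀eq x h2]
  rw [hpp'] at hp'
  have hpH : p ∈ H1 L := hp'.mem_H1 hL
  have hϖ := hW.add (hp'.smul (-ν ^ 2))
  refine ⟨⟨hz, hpH⟩, W + (-ν ^ 2) • p, hϖ.mem_H1 hL, ?_, ⟨u, hW.continuousOn hL, ?_, hu0, huL⟩,
    ?_, ?_⟩
  · exact (memLp_of_ac hL hϖ.ac ⊤).ae_eq hϖ.ae_eq.symm
  · have : W + (-ν ^ 2) • p + ν ^ 2 • p = W := by module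
    rw [this]
    exact hW.ae_eq
  · filter_upwards [hsub', hϖ.ae_eq, hp'.ae_eq] with x h1 h2 h3
    rw [mem_subdifferential_coe_iff, h2, ← h3]
    convert h1 using 5
    ring
  · rw [hϖ.weakDeriv_eq hL, hp'.weakDeriv_eq hL]
    module

/-! ### Multipliers for superposition functionals -/

lemma X.norm_sq_eq (q : X L) : ‖q‖ ^ 2 = ∫ x in Ioo (-L) L, q x ^ 2 := by
  rw [← real_inner_self_eq_norm_sq, X.inner_eq]
  simp only [sq]

lemma convexOn_integral {j : ℝ → ℝ → ℝ} (hjc : ∀ x, ConvexOn ℝ univ (j x))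
    (hji : ∀ q : X L, Integrable (fun x => j x (q x)) (omegaMeasure L)) :
    ConvexOn ℝ univ (fun q : X L => ∫ x in Ioo (-L) L, j x (q x)) := by
  refine ⟨convex_univ, fun p _ q _ a b ha hb hab => ?_⟩
  simp only [smul_eq_mul]
  rw [← integral_const_mul, ← integral_const_mul,
    ← integral_add ((hji p).const_mul a) ((hji q).const_mul b)]
  refine integral_mono_ae (hji _) (((hji p).const_mul a).add ((hji q).const_mul b)) ?_
  filter_upwards [Lp.coeFn_add (a • p) (b • q), Lp.coeFn_smul a p, Lp.coeFn_smul b q]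
    with x h1 h2 h3
  rw [h1, Pi.add_apply, h2, h3]
  exact (hjc x).2 (mem_univ _) (mem_univ _) ha hb hab

lemma continuous_of_convexOn_of_le_sq {E : Type*} [NormedAddCommGroup E] [NormedSpace ℝ E]
    {J : E → ℝ} (hJ : ConvexOn ℝ univ J) {a b : ℝ} (hb : 0 ≤ b)
    (h : ∀ q, J q ≤ a + b * ‖q‖ ^ 2) : Continuous J := by
  rw [← continuousOn_univ]
  refine ((hJ.continuousOn_tfae isOpen_univ univ_nonempty).out 3 1).1 ?_
  refine ⟨0, mem_univ _, a + b, ?_⟩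
  rw [eventually_map]
  filter_upwards [Metric.ball_mem_nhds (0 : E) one_pos] with q hq
  rw [mem_ball_zero_iff] at hq
  refine (h q).trans ?_
  have : ‖q‖ ^ 2 ≤ 1 := pow_le_one₀ (norm_nonneg q) hq.le
  nlinarith

lemma convexOn_gradientEnergy (hL : 0 < L) {g : ℝ → ℝ} (hg : IsQuadConvex g) :
    ConvexOn ℝ (H1 L) (fun y : X L => ∫ x in Ioo (-L) L, g (weakDeriv y x)) := by
  have hc := convexOn_integral (L := L) (fun _ => hg.convex) hg.integrable
  have hlin : ∀ p ∈ H1 L, ∀ q ∈ H1 L, ∀ a b : ℝ, a • p + b • q ∈ H1 L ∧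
      weakDeriv (a • p + b • q) = a • weakDeriv p + b • weakDeriv q := by
    intro p hp q hq a b
    have h1 := weakDeriv_smul hL hp a
    have h2 := weakDeriv_smul hL hq b
    have h3 := weakDeriv_add hL h1.1 h2.1
    rw [h1.2, h2.2] at h3
    exact h3
  refine ⟨fun p hp q hq a b _ _ _ => (hlin p hp q hq a b).1, fun p hp q hq a b ha hb hab => ?_⟩
  simp only
  rw [(hlin p hp q hq a b).2]
  exact hc.2 (mem_univ (weakDeriv p)) (mem_univ (weakDeriv q)) ha hb hab

/-- The quadratic bound makes the superposition term continuous on `X`, which the sum rule needs of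
one summand; the gradient term is only convex on `H¹`. The integrand depends on `x` to allow
penalties weighted by the load. -/
lemma exists_multiplier (hL : 0 < L) {g : ℝ → ℝ} (hg : IsQuadConvex g) {j : ℝ → ℝ → ℝ}
    (hjc : ∀ x, ConvexOn ℝ univ (j x))
    (hji : ∀ q : X L, Integrable (fun x => j x (q x)) (omegaMeasure L))
    {a b : ℝ} (hb : 0 ≤ b) (hjb : ∀ q : X L, ∫ x in Ioo (-L) L, j x (q x) ≤ a + b * ‖q‖ ^ 2)
    {z ζ : X L} (hz : z ∈ H1 L)
    (H : ∀ y ∈ H1 L, (∫ x in Ioo (-L) L, g (weakDeriv z x)) + (∫ x in Ioo (-L) L, j x (z x)) +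
      inner ℝ ζ (y - z) ≤
      (∫ x in Ioo (-L) L, g (weakDeriv y x)) + ∫ x in Ioo (-L) L, j x (y x)) :
    ∃ ξ : X L, (∀ᵐ x ∂(omegaMeasure L), ∀ r, j x (z x) + ξ x * (r - z x) ≤ j x r) ∧
      ∀ y ∈ H1 L, (∫ x in Ioo (-L) L, g (weakDeriv z x)) + inner ℝ (ζ - ξ) (y - z) ≤
        ∫ x in Ioo (-L) L, g (weakDeriv y x) := by
  have hJ := convexOn_integral hjc hji
  obtain ⟨ξ, h1, h2⟩ := exists_subgradient_of_add (convexOn_gradientEnergy hL hg) hJ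
    (continuous_of_convexOn_of_le_sq hJ hb hjb) hz H
  refine ⟨ξ, ae_subgradient_of_integral (fun x => (hjc x).locallyLipschitz.continuous) hji
    fun q => ?_, h2⟩
  rw [← X.inner_sub_eq]
  exact h1 q

/-! ### Truncation -/

/-- Truncation to the interval `[-m, m]`. -/
def clamp (m r : ℝ) : ℝ := max (-m) (min r m)

lemma lipschitzWith_clamp (m : ℝ) : LipschitzWith 1 (clamp m) :=
  (LipschitzWith.id.min_const m).const_max (-m)

/-- Increments of the truncation lie between `0` and those of the identity; `deriv_comp_between`
carries this over to derivatives. -/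
lemma clamp_slope {m : ℝ} (hm : 0 ≤ m) (r s : ℝ) :
    0 ≤ (clamp m r - clamp m s) * ((r - s) - (clamp m r - clamp m s)) := by
  unfold clamp
  rcases max_cases (-m) (min r m) with h1 | h1 <;> rcases max_cases (-m) (min s m) with h2 | h2 <;>
  rcases min_cases r m with h3 | h3 <;> rcases min_cases s m with h4 | h4 <;>
  rw [h1.1, h2.1] <;> simp only [h3.1, h4.1] at h1 h2 ⊢ <;> nlinarith

lemma clamp_mem {m : ℝ} (hm : 0 ≤ m) (r : ℝ) : clamp m r ∈ Icc (-m) m :=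
  ⟨le_max_left _ _, max_le (by linarith) (min_le_right _ _)⟩

lemma deriv_comp_between {S u : ℝ → ℝ} {a b x : ℝ}
    (hS : ∀ r s, 0 ≤ (S r - S s) * ((r - s) - (S r - S s)))
    (hu : HasDerivAt u b x) (hSu : HasDerivAt (fun x => S (u x)) a x) : 0 ≤ a * (b - a) := by
  refine ge_of_tendsto' (hSu.tendsto_slope.mul (hu.tendsto_slope.sub hSu.tendsto_slope))
    fun y => ?_
  rw [slope_def_field, slope_def_field, ← sub_div, div_mul_div_comm]
  exact div_nonneg (hS _ _) (mul_self_nonneg _)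

lemma exists_truncation (hL : 0 < L) {y : X L} (hy : y ∈ H1 L) :
    ∃ y₁ ∈ H1 L, (∀ᵐ x ∂(omegaMeasure L), y₁ x = clamp 1 (y x)) ∧
      ∀ᵐ x ∂(omegaMeasure L), 0 ≤ weakDeriv y₁ x * (weakDeriv y x - weakDeriv y₁ x) := by
  obtain ⟨u, hu⟩ := exists_isRep_of_mem_H1 hL hy
  obtain ⟨y₁, k, h₁⟩ := hu.exists_lipschitz_comp hL (lipschitzWith_clamp 1)
  refine ⟨y₁, h₁.mem_H1 hL, ?_, ?_⟩
  · filter_upwards [h₁.ae_eq, hu.ae_eq] with x h2 h3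
    rw [h2, h3]
  · rw [h₁.weakDeriv_eq hL]
    filter_upwards [h₁.hasDerivAt, hu.hasDerivAt] with x h2 h3
    exact deriv_comp_between (clamp_slope zero_le_one) h3 h2

/-! ### Exact penalization of the constraint -/

/-- The exact penalty for the constraint `|r| ≤ 1` under the load `t`. -/
def penalty (t r : ℝ) : ℝ := max t 0 * max (r - 1) 0 + max (-t) 0 * max (-1 - r) 0

lemma convexOn_penalty (t : ℝ) : ConvexOn ℝ univ (penalty t) := by
  have h1 : ConvexOn ℝ univ (fun r : ℝ => max (r - 1) 0) :=
    ConvexOn.sup (f := fun r : ℝ => r - 1) (g := fun _ => 0)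
      ⟨convex_univ, fun x _ y _ a b _ _ hab => by
        obtain rfl : b = 1 - a := by linarith
        simp only [smul_eq_mul]; apply le_of_eq; ring⟩ (convexOn_const 0 convex_univ)
  have h2 : ConvexOn ℝ univ (fun r : ℝ => max (-1 - r) 0) :=
    ConvexOn.sup (f := fun r : ℝ => -1 - r) (g := fun _ => 0)
      ⟨convex_univ, fun x _ y _ a b _ _ hab => by
        obtain rfl : b = 1 - a := by linarith
        simp only [smul_eq_mul]; apply le_of_eq; ring⟩ (convexOn_const 0 convex_univ)
  exact (h1.smul (le_max_right t 0)).add (h2.smul (le_max_right (-t) 0))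

lemma penalty_nonneg (t r : ℝ) : 0 ≤ penalty t r := by unfold penalty; positivity

lemma penalty_of_mem {t r : ℝ} (hr : r ∈ Icc (-1 : ℝ) 1) : penalty t r = 0 := by
  unfold penalty
  rw [max_eq_right (by linarith [hr.2] : r - 1 ≤ 0), max_eq_right (by linarith [hr.1] : -1 - r ≤ 0)]
  ring

lemma penalty_le (t r : ℝ) : penalty t r ≤ t ^ 2 + r ^ 2 := by
  have h1 : max t 0 ≤ |t| := max_le (le_abs_self t) (abs_nonneg t)
  have h2 : max (-t) 0 ≤ |t| := max_le (neg_le_abs t) (abs_nonneg t)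
  have h3 : max (r - 1) 0 ≤ |r| := max_le (by linarith [le_abs_self r]) (abs_nonneg r)
  have h4 : max (-1 - r) 0 ≤ |r| := max_le (by linarith [neg_le_abs r]) (abs_nonneg r)
  calc penalty t r ≤ |t| * |r| + |t| * |r| := by unfold penalty; gcongr
    _ ≤ t ^ 2 + r ^ 2 := by nlinarith [sq_nonneg (|t| - |r|), sq_abs t, sq_abs r]

/-- This makes the penalty exact: what the load gains by leaving `[-1, 1]` is at most the penalty.
The two sides differ by the cross terms of positive and negative parts. -/
lemma mul_sub_clamp_le_penalty (t r : ℝ) : t * (r - clamp 1 r) ≤ penalty t r := by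
  have ht : t = max t 0 - max (-t) 0 := by
    rcases le_total t 0 with h | h
    · rw [max_eq_right h, max_eq_left (by linarith)]; ring
    · rw [max_eq_left h, max_eq_right (by linarith)]; ring
  have hr : r - clamp 1 r = max (r - 1) 0 - max (-1 - r) 0 := by
    unfold clamp
    rcases le_total r 1 with h | h
    · rw [min_eq_left h, max_eq_right (by linarith : r - 1 ≤ 0)]
      rcases le_total r (-1) with h' | h'
      · rw [max_eq_left h', max_eq_left (by linarith)]; ring
      · rw [max_eq_right h', max_eq_right (by linarith)]; ring
    · rw [min_eq_right h, max_eq_left (by linarith : 0 ≤ r - 1), max_eq_right (by norm_num),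
        max_eq_right (by linarith)]; ring
  have h1 : 0 ≤ max t 0 := le_max_right _ _
  have h2 : 0 ≤ max (-t) 0 := le_max_right _ _
  have h3 : 0 ≤ max (r - 1) 0 := le_max_right _ _
  have h4 : 0 ≤ max (-1 - r) 0 := le_max_right _ _
  rw [hr]
  unfold penalty
  calc t * (max (r - 1) 0 - max (-1 - r) 0)
      = (max t 0 - max (-t) 0) * (max (r - 1) 0 - max (-1 - r) 0) := by rw [← ht]
    _ ≤ _ := by nlinarith [mul_nonneg h1 h4, mul_nonneg h2 h3]

lemma integrable_penalty (ζ q : X L) :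
    Integrable (fun x => penalty (ζ x) (q x)) (omegaMeasure L) := by
  have hc : Continuous fun w : ℝ × ℝ => penalty w.1 w.2 := by unfold penalty; fun_prop
  refine ((Lp.memLp ζ).integrable_sq.add (Lp.memLp q).integrable_sq).mono'
    (hc.comp_aestronglyMeasurable
      ((Lp.aestronglyMeasurable ζ).prodMk (Lp.aestronglyMeasurable q)))
    (Eventually.of_forall fun x => ?_)
  rw [Real.norm_of_nonneg (penalty_nonneg _ _)]
  exact penalty_le _ _

/-- Minimizers under the constraint `|z| ≤ 1` have a multiplier in `L²`. -/
lemma exists_multiplier_of_constraint (hL : 0 < L) {g : ℝ → ℝ} (hg : IsQuadConvex g)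
    {z ζ : X L} (hz : z ∈ H1 L) (hz1 : ∀ᵐ x ∂(omegaMeasure L), z x ∈ Icc (-1 : ℝ) 1)
    (H : ∀ y ∈ H1 L, (∀ᵐ x ∂(omegaMeasure L), y x ∈ Icc (-1 : ℝ) 1) →
      (∫ x in Ioo (-L) L, g (weakDeriv z x)) + inner ℝ ζ (y - z) ≤
      ∫ x in Ioo (-L) L, g (weakDeriv y x)) :
    ∃ ξ : X L,
      (∀ᵐ x ∂(omegaMeasure L), ∀ r ∈ Icc (-1 : ℝ) 1, ξ x * (r - z x) ≤ 0) ∧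
      ∀ y ∈ H1 L, (∫ x in Ioo (-L) L, g (weakDeriv z x)) + inner ℝ (ζ - ξ) (y - z) ≤
        ∫ x in Ioo (-L) L, g (weakDeriv y x) := by
  obtain ⟨ξ, h1, h2⟩ := exists_multiplier hL hg (j := fun x => penalty (ζ x))
    (fun x => convexOn_penalty _) (integrable_penalty ζ) (a := ‖ζ‖ ^ 2) (b := 1) zero_le_one
    (fun q => by
      rw [one_mul, X.norm_sq_eq, X.norm_sq_eq,
        ← integral_add (Lp.memLp ζ).integrable_sq (Lp.memLp q).integrable_sq]
      exact integral_mono (integrable_penalty ζ q)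
        ((Lp.memLp ζ).integrable_sq.add (Lp.memLp q).integrable_sq) fun x => penalty_le _ _)
    hz (ζ := ζ) (fun y hy => by
      -- The truncation is admissible in `H` and has no larger gradient energy; the penalty absorbs
      -- the change `⟨ζ, y - y₁⟩` of the load term.
      obtain ⟨y₁, hy₁, h3, h4⟩ := exists_truncation hL hy
      have h5 := H y₁ hy₁ (by
        filter_upwards [h3] with x hx
        rw [hx]; exact clamp_mem zero_le_one _)
      have h6 : ∫ x in Ioo (-L) L, g (weakDeriv y₁ x) ≤ ∫ x in Ioo (-L) L, g (weakDeriv y x) := by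
        refine integral_mono_ae (hg.integrable _) (hg.integrable _) ?_
        filter_upwards [h4] with x hx using hg.le_of_between hx
      have h7 : ∫ x in Ioo (-L) L, penalty (ζ x) (z x) = 0 := by
        refine integral_eq_zero_of_ae ?_
        filter_upwards [hz1] with x hx using penalty_of_mem hx
      have h8 : (inner ℝ ζ (y - y₁) : ℝ) ≤ ∫ x in Ioo (-L) L, penalty (ζ x) (y x) := by
        rw [X.inner_sub_eq]
        refine integral_mono_ae (integrable_mul_sub _ _ _) (integrable_penalty ζ y) ?_
        filter_upwards [h3] with x hx
        rw [hx]; exact mul_sub_clamp_le_penalty _ _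
      have h9 : (inner ℝ ζ (y - z) : ℝ) = inner ℝ ζ (y - y₁) + inner ℝ ζ (y₁ - z) := by
        rw [← inner_add_right]; congr 1; abel
      rw [h7, h9]
      linarith)
  refine ⟨ξ, ?_, h2⟩
  filter_upwards [h1, hz1] with x hx hx1 r hr
  have := hx r
  rw [penalty_of_mem hr, penalty_of_mem hx1] at this
  linarith

/-! ### Values of the energies -/

lemma V_eq (hL : 0 < L) {f : ℝ → ℝ → ℝ} (hf : IsAbsRegularization f) {ε : ℝ}
    (hε : ε ∈ Icc (0 : ℝ) 1) {z : X L} (hz : z ∈ H1 L) :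
    V f ε z = ((∫ x in Ioo (-L) L, f ε (weakDeriv z x) : ℝ) : EReal) := by
  unfold V
  split_ifs with h
  · subst h
    simp only [totalVariation_eq hL hz, hf.zero_param]
  · exact (hf.isQuadConvex hε).integralFunctional_eq _

lemma VD_eq {ν : ℝ} {z : X L} (hz : z ∈ H1 L) :
    VD ν z = ((∫ x in Ioo (-L) L, ν ^ 2 / 2 * weakDeriv z x ^ 2 : ℝ) : EReal) := by
  unfold VD
  rw [if_pos hz, integral_const_mul]
  simp only [sq_abs]

lemma VD_of_notMem {ν : ℝ} {z : X L} (hz : z ∉ H1 L) : VD ν z = ⊤ := if_neg hz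

lemma Psi_eq (hL : 0 < L) {f Khat : ℝ → ℝ → ℝ} (hf : IsAbsRegularization f) {ν ε δ : ℝ}
    (hε : ε ∈ Icc (0 : ℝ) 1) {z : X L} (hz : z ∈ H1 L) :
    Psi f Khat ν ε δ z =
      ((∫ x in Ioo (-L) L, (f ε (weakDeriv z x) + ν ^ 2 / 2 * weakDeriv z x ^ 2) : ℝ) : EReal) +
        constraintEnergy Khat δ z := by
  rw [Psi, if_pos hz, Phi, V_eq hL hf hε hz, VD_eq hz, ← EReal.coe_add, ← integral_add
    ((hf.isQuadConvex hε).integrable _) ((Lp.memLp _).integrable_sq.const_mul _)]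

lemma constraintEnergy_eq {Khat : ℝ → ℝ → ℝ} (hK : IsIndicatorRegularization Khat) {δ : ℝ}
    (hδ : δ ∈ Ioc (0 : ℝ) 1) (z : X L) :
    constraintEnergy Khat δ z = ((∫ x in Ioo (-L) L, Khat δ (z x) : ℝ) : EReal) := by
  rw [← (hK.isQuadConvex hδ).integralFunctional_eq]
  unfold constraintEnergy
  congr 1
  funext r
  rw [potential, if_neg hδ.1.ne']

lemma constraintEnergy_nonneg (Khat : ℝ → ℝ → ℝ) (δ : ℝ) (z : X L) :
    0 ≤ constraintEnergy Khat δ z := EReal.coe_ennreal_nonneg _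

lemma measurable_convexIndicator : Measurable convexIndicator :=
  Measurable.ite measurableSet_Icc measurable_const measurable_const

lemma mem_Icc_of_constraintEnergy_ne_top {Khat : ℝ → ℝ → ℝ} {z : X L}
    (h : constraintEnergy Khat 0 z ≠ ⊤) : ∀ᵐ x ∂(omegaMeasure L), z x ∈ Icc (-1 : ℝ) 1 := by
  have hpot : potential Khat 0 = convexIndicator := by
    funext r; rw [potential, if_pos rfl]
  rw [constraintEnergy, hpot, integralFunctional] at h
  have h' : ∫⁻ x, (convexIndicator (z x)).toENNReal ∂(omegaMeasure L) ≠ ⊤ := fun h' =>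
    h (by rw [h']; rfl)
  have hm : AEMeasurable (fun x => (convexIndicator (z x)).toENNReal) (omegaMeasure L) :=
    (measurable_convexIndicator.comp_aemeasurable
      (Lp.aestronglyMeasurable z).aemeasurable).ereal_toENNReal
  filter_upwards [ae_lt_top' hm h'] with x hx
  by_contra hx'
  rw [convexIndicator, if_neg hx'] at hx
  simp at hx

lemma constraintEnergy_zero_of_mem {Khat : ℝ → ℝ → ℝ} {z : X L}
    (h : ∀ᵐ x ∂(omegaMeasure L), z x ∈ Icc (-1 : ℝ) 1) : constraintEnergy Khat 0 z = 0 := by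
  have hpot : potential Khat 0 = convexIndicator := by
    funext r; rw [potential, if_pos rfl]
  rw [constraintEnergy, hpot, integralFunctional]
  have : ∫⁻ x, (convexIndicator (z x)).toENNReal ∂(omegaMeasure L) = 0 := by
    refine lintegral_eq_zero_of_ae_eq_zero ?_
    filter_upwards [h] with x hx
    rw [convexIndicator, if_pos hx]
    simp
  rw [this]
  rfl

lemma X.zero_ae : ∀ᵐ x ∂(omegaMeasure L), (0 : X L) x = 0 := Lp.coeFn_zero ℝ 2 (omegaMeasure L)

lemma IsQuadConvex.integral_zero {h : ℝ → ℝ} (hh : IsQuadConvex h) :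
    ∫ x in Ioo (-L) L, h ((0 : X L) x) = 0 := by
  refine integral_eq_zero_of_ae ?_
  filter_upwards [X.zero_ae (L := L)] with x hx
  rw [hx, hh.map_zero]; rfl

lemma constraintEnergy_zero {Khat : ℝ → ℝ → ℝ} (hK : IsIndicatorRegularization Khat) {δ : ℝ}
    (hδ : δ ∈ Icc (0 : ℝ) 1) : constraintEnergy Khat δ (0 : X L) = 0 := by
  rcases eq_or_lt_of_le hδ.1 with rfl | h0
  · refine constraintEnergy_zero_of_mem ?_
    filter_upwards [X.zero_ae (L := L)] with x hx
    rw [hx]; norm_num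
  · rw [constraintEnergy_eq hK ⟨h0, hδ.2⟩, (hK.isQuadConvex ⟨h0, hδ.2⟩).integral_zero]
    rfl

/-- Testing a subgradient with `y = 0` shows that the energy is finite at its base point. -/
lemma Psi_zero (hL : 0 < L) {f Khat : ℝ → ℝ → ℝ} (hf : IsAbsRegularization f)
    (hK : IsIndicatorRegularization Khat) {ν ε δ : ℝ} (hε : ε ∈ Icc (0 : ℝ) 1)
    (hδ : δ ∈ Icc (0 : ℝ) 1) : Psi f Khat ν ε δ (0 : X L) = 0 := by
  rw [Psi_eq hL hf hε (weakDeriv_zero hL).1, constraintEnergy_zero hK hδ, (weakDeriv_zero hL).2,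
    ((hf.isQuadConvex hε).add_sq ν).integral_zero]
  simp

/-! ### Necessary conditions -/

lemma ne_top_of_add_coe_le_zero {a : EReal} {r : ℝ} (h : a + r ≤ 0) : a ≠ ⊤ := by
  rintro rfl
  rw [EReal.top_add_coe] at h
  exact absurd h (by simp)

lemma exists_of_mem_subdifferential_Psi (hL : 0 < L) {ν : ℝ} (hν : 0 < ν)
    {f Khat : ℝ → ℝ → ℝ} (hf : IsAbsRegularization f) (hK : IsIndicatorRegularization Khat)
    {ε : ℝ} (hε : ε ∈ Icc (0 : ℝ) 1) {δ : ℝ} (hδ : δ ∈ Icc (0 : ℝ) 1) {z zs : X L}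
    (h : zs ∈ subdifferential (Psi f Khat ν ε δ) z) :
    z ∈ H2 L ∧ ∃ ϖ ξ : X L,
      ϖ ∈ H1 L ∧ MemLp ϖ ⊤ (omegaMeasure L) ∧
      VanishesAtBoundary (ϖ + ν ^ 2 • weakDeriv z) ∧
      (∀ᵐ x ∂(omegaMeasure L),
        ϖ x ∈ subdifferential (fun r : ℝ => ((f ε r : ℝ) : EReal)) (weakDeriv z x)) ∧
      (∀ᵐ x ∂(omegaMeasure L), ξ x ∈ constraintGraph Khat δ (z x)) ∧
      zs = -weakDeriv ϖ - ν ^ 2 • weakDeriv (weakDeriv z) + ξ := by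
  have hfin : Psi f Khat ν ε δ z ≠ ⊤ := by
    have := h 0
    rw [Psi_zero hL hf hK hε hδ] at this
    exact ne_top_of_add_coe_le_zero this
  have hz : z ∈ H1 L := by
    by_contra hz
    exact hfin (by rw [Psi, if_neg hz])
  have hq := hf.isQuadConvex hε
  have hg := hq.add_sq ν
  rw [Psi_eq hL hf hε hz] at hfin
  have hcz : constraintEnergy Khat δ z ≠ ⊤ := fun h' => hfin (by rw [h', EReal.coe_add_top])
  suffices hξ : ∃ ξ : X L, (∀ᵐ x ∂(omegaMeasure L), ξ x ∈ constraintGraph Khat δ (z x)) ∧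
      ∀ y ∈ H1 L,
        (∫ x in Ioo (-L) L, (f ε (weakDeriv z x) + ν ^ 2 / 2 * weakDeriv z x ^ 2)) +
          inner ℝ (zs - ξ) (y - z) ≤
        ∫ x in Ioo (-L) L, (f ε (weakDeriv y x) + ν ^ 2 / 2 * weakDeriv y x ^ 2) by
    obtain ⟨ξ, hξ1, hξ2⟩ := hξ
    obtain ⟨h2, ϖ, h3, h4, h5, h6, h7⟩ :=
      exists_decomposition_of_subgradient hL hq hν hz hξ2
    exact ⟨h2, ϖ, ξ, h3, h4, h5, h6, hξ1, by rw [← h7, sub_add_cancel]⟩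
  rcases eq_or_lt_of_le hδ.1 with rfl | h0
  · have hz1 := mem_Icc_of_constraintEnergy_ne_top hcz
    obtain ⟨ξ, h1, h2⟩ := exists_multiplier_of_constraint hL hg (ζ := zs) hz hz1 (by
      intro y hy hy1
      have h3 := h y
      rw [Psi_eq hL hf hε hz, Psi_eq hL hf hε hy, constraintEnergy_zero_of_mem hz1,
        constraintEnergy_zero_of_mem hy1, add_zero, add_zero, ← EReal.coe_add,
        EReal.coe_le_coe_iff] at h3
      exact h3)
    refine ⟨ξ, ?_, h2⟩
    filter_upwards [h1, hz1] with x hx hx1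
    rw [constraintGraph, if_pos rfl]
    intro r
    by_cases hr : r ∈ Icc (-1 : ℝ) 1
    · rw [convexIndicator, convexIndicator, if_pos hx1, if_pos hr, zero_add]
      have := hx r hr
      exact_mod_cast (by simpa [mul_comm] using this : inner ℝ (ξ x) (r - z x) ≤ (0 : ℝ))
    · rw [convexIndicator, convexIndicator, if_neg hr]
      exact le_top
  · have hδ' : δ ∈ Ioc (0 : ℝ) 1 := ⟨h0, hδ.2⟩
    have hKq := hK.isQuadConvex hδ'
    obtain ⟨C, hC⟩ := hKq.growth
    have hC0 : 0 ≤ C := by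
      have := (hKq.nonneg 0).trans (hC 0)
      simpa using this
    obtain ⟨ξ, h1, h2⟩ := exists_multiplier hL hg (j := fun _ => Khat δ) (fun _ => hKq.convex)
      hKq.integrable (a := C * (omegaMeasure L).real univ) (b := C) hC0
      (fun q => by
        have hi : Integrable (fun x => 1 + q x ^ 2) (omegaMeasure L) :=
          (integrable_const 1).add (Lp.memLp q).integrable_sq
        calc ∫ x in Ioo (-L) L, Khat δ (q x) ≤ ∫ x in Ioo (-L) L, C * (1 + q x ^ 2) :=
              integral_mono (hKq.integrable q) (hi.const_mul C) fun x => hC _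
          _ = _ := by
              rw [integral_const_mul, integral_add (integrable_const 1)
                (Lp.memLp q).integrable_sq, integral_const, X.norm_sq_eq, smul_eq_mul]
              ring)
      hz (ζ := zs) (fun y hy => by
        have h3 := h y
        rw [Psi_eq hL hf hε hz, Psi_eq hL hf hε hy, constraintEnergy_eq hK hδ',
          constraintEnergy_eq hK hδ', ← EReal.coe_add, ← EReal.coe_add, ← EReal.coe_add,
          EReal.coe_le_coe_iff] at h3
        exact h3)
    refine ⟨ξ, ?_, h2⟩
    filter_upwards [h1] with x hx
    rw [constraintGraph, if_neg h0.ne']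
    exact eq_deriv_of_subgradient
      (((hK.contDiff δ hδ').differentiable (by norm_num)) _).hasDerivAt hx

/-! ### Fluxes vanishing at the boundary -/

/-- Zeros of `u` with nonzero derivative are isolated among the zeros, hence countable and null. -/
lemma IsRep.ae_eq_zero_of_zero {u : ℝ → ℝ} {ϖ k : X L} (hu : IsRep u ϖ k) :
    ∀ᵐ x ∂(omegaMeasure L), u x = 0 → k x = 0 := by
  let S : Set ℝ := {x | u x = 0 ∧ HasDerivAt u (k x) x ∧ k x ≠ 0}
  have hd : DiscreteTopology S := by
    rw [discreteTopology_subtype_iff]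
    rintro x ⟨_, h2, h3⟩
    rw [← disjoint_iff, disjoint_principal_right]
    filter_upwards [h2.eventually_ne (c := 0) h3] with y hy hy'
    exact hy hy'.1
  have hc : S.Countable := TopologicalSpace.separableSpace_iff_countable.1 inferInstance
  have hS : ∀ᵐ x ∂(omegaMeasure L), x ∉ S := hc.ae_notMem _
  filter_upwards [hS, hu.hasDerivAt] with x h1 h2 h3
  by_contra h4
  exact h1 ⟨h3, h2, h4⟩

/-- Functions in `H¹` with values in `[-1, 1]` that vanish at the boundary are admissible in the
definition of the total variation. -/
lemma coe_neg_integral_le_totalVariation (hL : 0 < L) {u : ℝ → ℝ} {ϖ k : X L}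
    (hu : IsRep u ϖ k) (hu0 : u (-L) = 0) (huL : u L = 0)
    (hu1 : ∀ x ∈ Icc (-L) L, |u x| ≤ 1) (y : X L) :
    ((-∫ x in Ioo (-L) L, k x * y x : ℝ) : EReal) ≤ totalVariation y := by
  by_contra! hlt
  obtain ⟨r, hr1, hr2⟩ := EReal.lt_iff_exists_real_btwn.1 hlt
  rw [EReal.coe_lt_coe_iff] at hr2
  have hLL : -L ≤ L := by linarith
  -- Constant extension is extension by zero here, because `u` vanishes at `±L`.
  let U : ℝ → ℝ := IccExtend hLL ((Icc (-L) L).domRestrict u)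
  have hUc : Continuous U := (hu.continuousOn hL).domRestrict.Icc_extend'
  have hUu : ∀ x ∈ Icc (-L) L, U x = u x := fun x hx => by
    simp only [U]; rw [IccExtend_of_mem hLL _ hx]; rfl
  have hU0 : ∀ x, x ∉ Ioo (-L) L → U x = 0 := by
    intro x hx
    rcases le_or_gt x (-L) with h | h
    · simp only [U]; rw [IccExtend_of_le_left hLL _ h]; exact hu0
    · have : L ≤ x := by
        by_contra! h'
        exact hx ⟨h, h'⟩
      simp only [U]; rw [IccExtend_of_right_le hLL _ this]; exact huL
  have hU1 : ∀ x, |U x| ≤ 1 := by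
    intro x
    by_cases hx : x ∈ Ioo (-L) L
    · rw [hUu x (Ioo_subset_Icc_self hx)]; exact hu1 x (Ioo_subset_Icc_self hx)
    · rw [hU0 x hx]; simp
  -- The test functions are `clamp η u - u`: they vanish where `|u| ≤ η`, in particular near `±L`,
  -- and tend to `-u`.
  let η : ℕ → ℝ := fun n => 1 / ((n : ℝ) + 1)
  have hη : ∀ n, 0 < η n := fun n => by positivity
  have hηlim : Tendsto η atTop (𝓝 0) := tendsto_one_div_add_atTop_nhds_zero_nat
  choose w a ha using fun n => hu.exists_lipschitz_comp hL (lipschitzWith_clamp (η n))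
  have hφ : ∀ n, IsRep (fun x => clamp (η n) (u x) + -1 * u x) (w n + (-1 : ℝ) • ϖ)
      (a n + (-1 : ℝ) • k) := fun n => (ha n).add (hu.smul (-1))
  have hbetween : ∀ᵐ x ∂(omegaMeasure L), ∀ n, 0 ≤ a n x * (k x - a n x) := by
    refine ae_all_iff.2 fun n => ?_
    filter_upwards [(ha n).hasDerivAt, hu.hasDerivAt] with x h2 h3
    exact deriv_comp_between (clamp_slope (hη n).le) h3 h2
  -- The derivative `a n` of the truncation is zero once `η n < |u x|`; where `u = 0`, also `k = 0`
  -- a.e., and `a n` lies between `0` and `k`.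
  have hlim : Tendsto (fun n => ∫ x in Ioo (-L) L, a n x * y x) atTop (𝓝 0) := by
    rw [show (0 : ℝ) = ∫ x in Ioo (-L) L, (0 : ℝ) by simp]
    refine tendsto_integral_of_dominated_convergence (fun x => |k x * y x|)
      (fun n => (X.integrable_mul _ _).aestronglyMeasurable) (X.integrable_mul _ _).abs
      (fun n => ?_) ?_
    · filter_upwards [hbetween] with x hx
      rw [Real.norm_eq_abs, abs_mul, abs_mul]
      refine mul_le_mul_of_nonneg_right (sq_le_sq.1 ?_) (abs_nonneg _)
      nlinarith [hx n, sq_nonneg (k x - a n x)]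
    · filter_upwards [hbetween, hu.ae_eq_zero_of_zero, ae_all_iff.2 fun n => (ha n).hasDerivAt,
        hu.hasDerivAt] with x h1 h2 h3 h4
      refine tendsto_const_nhds.congr' ?_
      by_cases hx : u x = 0
      · refine Eventually.of_forall fun n => ?_
        have := h1 n
        rw [h2 hx] at this
        have : a n x = 0 := by nlinarith [sq_nonneg (a n x)]
        simp only [this, zero_mul]
      · filter_upwards [hηlim.eventually (gt_mem_nhds (abs_pos.2 hx))] with n hn
        have hcont := h4.continuousAt
        have hconst : ∃ c : ℝ, (fun t => clamp (η n) (u t)) =ᶠ[𝓝 x] fun _ => c := by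
          rcases lt_abs.1 hn with h | h
          · refine ⟨η n, ?_⟩
            filter_upwards [hcont.eventually (lt_mem_nhds h)] with t ht
            unfold clamp
            rw [min_eq_right ht.le, max_eq_right (by linarith [hη n])]
          · refine ⟨-η n, ?_⟩
            filter_upwards [hcont.eventually (gt_mem_nhds (show u x < -η n by linarith))] with t ht
            unfold clamp
            rw [min_eq_left (by linarith [hη n]), max_eq_left ht.le]
        obtain ⟨c, hc⟩ := hconst
        have : a n x = 0 := (h3 n).unique ((hasDerivAt_const x c).congr_of_eventuallyEq hc)
        simp only [this, zero_mul]
  have hle : ∀ n, (∫ x in Ioo (-L) L, a n x * y x) - ∫ x in Ioo (-L) L, k x * y x ≤ r := by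
    intro n
    let c : ℝ → ℝ := fun x => clamp (η n) (U x) + -1 * U x
    have hclamp : ∀ s, |s| ≤ η n → clamp (η n) s + -1 * s = 0 := by
      intro s hs
      rw [abs_le] at hs
      unfold clamp
      rw [min_eq_left hs.2, max_eq_right hs.1]; ring
    have hcc : Continuous c :=
      ((lipschitzWith_clamp (η n)).continuous.comp hUc).add (continuous_const.mul hUc)
    have hsupp : tsupport c ⊆ {x | η n ≤ |U x|} := by
      refine closure_minimal (fun x hx => ?_) (isClosed_le continuous_const hUc.abs)
      by_contra h'
      exact hx (hclamp _ (not_le.1 h').le)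
    have hsub : {x | η n ≤ |U x|} ⊆ Ioo (-L) L := by
      intro x hx
      by_contra h'
      rw [mem_ofPred_eq, hU0 x h', abs_zero] at hx
      linarith [hη n]
    have hmem : ((∫ x in Ioo (-L) L, y x * weakDeriv (w n + (-1 : ℝ) • ϖ) x : ℝ) : EReal) ≤
        totalVariation y := by
      refine le_sSup ⟨w n + (-1 : ℝ) • ϖ, c, (hφ n).mem_H1 hL, ?_, hcc, ?_,
        hsupp.trans hsub, ?_, rfl⟩
      · filter_upwards [(hφ n).ae_eq, ae_restrict_mem measurableSet_Ioo] with x h1 h2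
        rw [h1]
        simp only [c, hUu x (Ioo_subset_Icc_self h2)]
      · exact isCompact_Icc.of_isClosed_subset (isClosed_tsupport c)
          ((hsupp.trans hsub).trans Ioo_subset_Icc_self)
      · intro x _
        -- The truncation lies between `0` and `U x`, so `|c x| ≤ |U x| ≤ 1`.
        have h1 := clamp_slope (hη n).le (U x) 0
        have h2 : clamp (η n) 0 = 0 := by
          have := hclamp 0 (by simpa using (hη n).le)
          simpa using this
        rw [h2, sub_zero, sub_zero] at h1
        refine le_trans (sq_le_sq.1 ?_) (hU1 x)
        simp only [c]
        nlinarith [sq_nonneg (clamp (η n) (U x))]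
    have h1 := hmem.trans_lt hr1
    rw [EReal.coe_lt_coe_iff, (hφ n).weakDeriv_eq hL, ← X.inner_eq, inner_add_right,
      inner_smul_right, real_inner_comm, real_inner_comm k, X.inner_eq, X.inner_eq] at h1
    linarith
  have h2 := le_of_tendsto' (hlim.sub_const (∫ x in Ioo (-L) L, k x * y x)) hle
  linarith

lemma integral_add_inner_le (hL : 0 < L) {h : ℝ → ℝ} (hh : IsQuadConvex h) {u : ℝ → ℝ}
    {ϖ k : X L} (hu : IsRep u ϖ k) (hu0 : u (-L) = 0) (huL : u L = 0) {z y : X L}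
    (hz : z ∈ H1 L) (hy : y ∈ H1 L)
    (hsub : ∀ᵐ x ∂(omegaMeasure L), ∀ r,
      h (weakDeriv z x) + ϖ x * (r - weakDeriv z x) ≤ h r) :
    (∫ x in Ioo (-L) L, h (weakDeriv z x)) + inner ℝ (-k) (y - z) ≤
      ∫ x in Ioo (-L) L, h (weakDeriv y x) := by
  have hyz := weakDeriv_sub hL hy hz
  obtain ⟨v, hv⟩ := exists_isRep_of_mem_H1 hL hyz.1
  have h1 := hu.integral_mul hL hv
  rw [hu0, huL, zero_mul, zero_mul, sub_zero, zero_sub, hyz.2, ← X.inner_eq, ← X.inner_eq,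
    X.inner_sub_eq] at h1
  rw [inner_neg_left, ← h1, ← integral_add (hh.integrable _) (integrable_mul_sub _ _ _)]
  refine integral_mono_ae ((hh.integrable _).add (integrable_mul_sub _ _ _)) (hh.integrable _) ?_
  filter_upwards [hsub] with x hx using hx _

/-- Testing with `r = 0` gives `ϖ p ≥ 0`, while `ϖ = -ν² p` at `±L`; so both vanish there. This
decouples the boundary condition into one for each summand. -/
lemma boundary_values_eq_zero (hL : 0 < L) {h : ℝ → ℝ} (hh : IsQuadConvex h) {ν : ℝ}
    (hν : 0 < ν) {u v : ℝ → ℝ} {ϖ p k q : X L} (hu : IsRep u ϖ k) (hv : IsRep v p q)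
    (hb : VanishesAtBoundary (ϖ + ν ^ 2 • p))
    (hsub : ∀ᵐ x ∂(omegaMeasure L), ∀ r, h (p x) + ϖ x * (r - p x) ≤ h r) :
    ∀ x, x = -L ∨ x = L → u x = 0 ∧ v x = 0 := by
  obtain ⟨c, hc, hcw, hc1, hc2⟩ := hb
  have hsum := (hu.add (hv.smul (ν ^ 2))).eq_of_ae_eq hL hc hcw
  -- Nonnegativity is written as an equation of continuous functions, so that it passes from a.e. to
  -- the endpoints.
  have hprod : EqOn (fun x => u x * v x) (fun x => |u x * v x|) (Icc (-L) L) := by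
    have hcont := (hu.continuousOn hL).mul (hv.continuousOn hL)
    refine Measure.eqOn_Icc_of_ae_eq volume (by linarith) ?_ hcont hcont.abs
    rw [← restrict_Ioo_eq_restrict_Icc]
    filter_upwards [hu.ae_eq, hv.ae_eq, hsub] with x h1 h2 h3
    have h4 := h3 0
    rw [hh.map_zero, h1, h2] at h4
    rw [abs_of_nonneg]
    nlinarith [hh.nonneg (v x)]
  intro x hx
  have hxI : x ∈ Icc (-L) L := by
    rcases hx with rfl | rfl
    · exact left_mem_Icc.2 (by linarith)
    · exact right_mem_Icc.2 (by linarith)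
  have h1 : u x + ν ^ 2 * v x = 0 := by
    refine (hsum hxI).trans ?_
    rcases hx with rfl | rfl <;> assumption
  have h2 : 0 ≤ u x * v x := by
    have := hprod hxI
    simp only at this
    rw [this]; exact abs_nonneg _
  have hν2 : 0 < ν ^ 2 := by positivity
  have h3 : v x = 0 := by
    have h4 : u x = -(ν ^ 2 * v x) := by linarith
    rw [h4] at h2
    have h5 : v x ^ 2 = 0 := by nlinarith [sq_nonneg (v x)]
    exact pow_eq_zero_iff two_ne_zero |>.1 h5
  rw [h3] at h1
  exact ⟨by linarith, h3⟩

/-! ### Sufficient conditions -/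

lemma abs_subgradient {p w : ℝ} (h : ∀ r, |p| + w * (r - p) ≤ |r|) : |w| ≤ 1 ∧ w * p = |p| := by
  have h0 := h 0
  have h2 := h (2 * p)
  have hp := h (p + 1)
  have hm := h (p - 1)
  have e1 := abs_add_le p 1
  have e2 := abs_sub p 1
  rw [abs_mul, abs_two] at h2
  rw [abs_one] at e1 e2
  rw [abs_zero] at h0
  exact ⟨abs_le.2 ⟨by linarith, by linarith⟩, by linarith⟩

/-- For `ε = 0` the competitor ranges over all of `X`: `ϖ` satisfies `|ϖ| ≤ 1`, bounds `V⁰(y)` from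
below by duality, and attains `V⁰(z)` since `ϖ ∂ₓz = |∂ₓz|`. For `ε ≠ 0` the energy is infinite
outside `H¹`. -/
lemma mem_subdifferential_V (hL : 0 < L) {f : ℝ → ℝ → ℝ} (hf : IsAbsRegularization f) {ε : ℝ}
    (hε : ε ∈ Icc (0 : ℝ) 1) {u : ℝ → ℝ} {ϖ k z : X L} (hu : IsRep u ϖ k) (hu0 : u (-L) = 0)
    (huL : u L = 0) (hz : z ∈ H1 L)
    (hsub : ∀ᵐ x ∂(omegaMeasure L), ∀ r,
      f ε (weakDeriv z x) + ϖ x * (r - weakDeriv z x) ≤ f ε r) :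
    -k ∈ subdifferential (V f ε) z := by
  intro y
  rw [V_eq hL hf hε hz, ← EReal.coe_add]
  by_cases h0 : ε = 0
  · subst h0
    simp only [hf.zero_param] at hsub ⊢
    rw [V, if_pos rfl]
    have hu1 : EqOn (fun x => max |u x| 1) (fun _ => 1) (Icc (-L) L) := by
      refine Measure.eqOn_Icc_of_ae_eq volume (by linarith) ?_
        ((hu.continuousOn hL).abs.sup continuousOn_const) continuousOn_const
      rw [← restrict_Ioo_eq_restrict_Icc]
      filter_upwards [hu.ae_eq, hsub] with x h1 h2
      rw [← h1]
      exact max_eq_right (abs_subgradient h2).1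
    obtain ⟨v, hv⟩ := exists_isRep_of_mem_H1 hL hz
    have h1 := hu.integral_mul hL hv
    rw [hu0, huL, zero_mul, zero_mul, sub_zero, zero_sub] at h1
    have h2 : ∫ x in Ioo (-L) L, |weakDeriv z x| = ∫ x in Ioo (-L) L, ϖ x * weakDeriv z x := by
      refine integral_congr_ae ?_
      filter_upwards [hsub] with x hx
      exact (abs_subgradient hx).2.symm
    refine le_trans (le_of_eq ?_) (coe_neg_integral_le_totalVariation hL hu hu0 huL
      (fun x hx => max_eq_right_iff.1 (hu1 hx)) y)
    rw [h2, h1, inner_neg_left, inner_sub_right, X.inner_eq, X.inner_eq]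
    congr 1
    ring
  · by_cases hy : y ∈ H1 L
    · rw [V_eq hL hf hε hy, EReal.coe_le_coe_iff]
      exact integral_add_inner_le hL (hf.isQuadConvex hε) hu hu0 huL hz hy hsub
    · rw [V, if_neg h0, if_neg hy]
      exact le_top

lemma isQuadConvex_sq (ν : ℝ) : IsQuadConvex (fun r => ν ^ 2 / 2 * r ^ 2) := by
  have h : IsQuadConvex (fun _ : ℝ => (0 : ℝ)) :=
    ⟨convexOn_const 0 convex_univ, fun _ => le_rfl, rfl, 0, fun r => by simp⟩
  simpa using h.add_sq ν

lemma mem_subdifferential_VD (hL : 0 < L) {ν : ℝ} {v : ℝ → ℝ} {q z : X L} (hz : z ∈ H1 L)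
    (hv : IsRep v (weakDeriv z) q) (hv0 : v (-L) = 0) (hvL : v L = 0) :
    -(ν ^ 2 • q) ∈ subdifferential (VD ν) z := by
  intro y
  by_cases hy : y ∈ H1 L
  · rw [VD_eq hz, VD_eq hy, ← EReal.coe_add, EReal.coe_le_coe_iff]
    refine integral_add_inner_le hL (isQuadConvex_sq ν) (hv.smul (ν ^ 2)) (by simp [hv0])
      (by simp [hvL]) hz hy ?_
    filter_upwards [Lp.coeFn_smul (ν ^ 2) (weakDeriv z)] with x hx r
    rw [hx, Pi.smul_apply, smul_eq_mul]
    nlinarith [mul_nonneg (sq_nonneg ν) (sq_nonneg (r - weakDeriv z x))]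
  · rw [VD_of_notMem hy]
    exact le_top

lemma mem_subdifferential_constraintEnergy {Khat : ℝ → ℝ → ℝ}
    (hK : IsIndicatorRegularization Khat) {δ : ℝ} (hδ : δ ∈ Icc (0 : ℝ) 1) {ξ z : X L}
    (hξ : ∀ᵐ x ∂(omegaMeasure L), ξ x ∈ constraintGraph Khat δ (z x)) :
    ξ ∈ subdifferential (constraintEnergy Khat δ) z := by
  intro y
  rcases eq_or_lt_of_le hδ.1 with rfl | h0
  · by_cases hy : constraintEnergy Khat 0 y = ⊤
    · rw [hy]; exact le_top
    · have hy1 := mem_Icc_of_constraintEnergy_ne_top hy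
      simp only [constraintGraph, if_pos] at hξ
      have hz1 : ∀ᵐ x ∂(omegaMeasure L), z x ∈ Icc (-1 : ℝ) 1 := by
        filter_upwards [hξ] with x hx
        by_contra h'
        have h1 := hx 0
        rw [convexIndicator, convexIndicator, if_neg h', if_pos (by norm_num)] at h1
        exact ne_top_of_add_coe_le_zero h1 rfl
      rw [constraintEnergy_zero_of_mem hz1, constraintEnergy_zero_of_mem hy1, zero_add,
        X.inner_sub_eq]
      have : ∫ x in Ioo (-L) L, ξ x * (y x - z x) ≤ 0 := by
        refine integral_nonpos_of_ae ?_
        filter_upwards [hξ, hz1, hy1] with x h1 h2 h3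
        have h4 := h1 (y x)
        rw [convexIndicator, convexIndicator, if_pos h2, if_pos h3, zero_add] at h4
        have h5 : (inner ℝ (ξ x) (y x - z x) : ℝ) ≤ 0 := by exact_mod_cast h4
        simpa [mul_comm] using h5
      exact_mod_cast this
  · have hδ' : δ ∈ Ioc (0 : ℝ) 1 := ⟨h0, hδ.2⟩
    have hKq := hK.isQuadConvex hδ'
    rw [constraintEnergy_eq hK hδ', constraintEnergy_eq hK hδ', ← EReal.coe_add,
      EReal.coe_le_coe_iff, X.inner_sub_eq,
      ← integral_add (hKq.integrable z) (integrable_mul_sub _ _ _)]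
    refine integral_mono_ae ((hKq.integrable z).add (integrable_mul_sub _ _ _))
      (hKq.integrable y) ?_
    filter_upwards [hξ] with x hx
    rw [constraintGraph, if_neg h0.ne', mem_singleton_iff] at hx
    simp only [hx]
    exact hKq.convex.add_deriv_mul_le
      (((hK.contDiff δ hδ').differentiable (by norm_num)) _).hasDerivAt _

lemma mem_sum_of_decomposition (hL : 0 < L) {ν : ℝ} (hν : 0 < ν)
    {f Khat : ℝ → ℝ → ℝ} (hf : IsAbsRegularization f) (hK : IsIndicatorRegularization Khat)
    {ε : ℝ} (hε : ε ∈ Icc (0 : ℝ) 1) {δ : ℝ} (hδ : δ ∈ Icc (0 : ℝ) 1) {z ϖ ξ : X L}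
    (hz : z ∈ H2 L) (hϖ : ϖ ∈ H1 L) (hb : VanishesAtBoundary (ϖ + ν ^ 2 • weakDeriv z))
    (hsub : ∀ᵐ x ∂(omegaMeasure L),
      ϖ x ∈ subdifferential (fun r : ℝ => ((f ε r : ℝ) : EReal)) (weakDeriv z x))
    (hξ : ∀ᵐ x ∂(omegaMeasure L), ξ x ∈ constraintGraph Khat δ (z x)) :
    -weakDeriv ϖ - ν ^ 2 • weakDeriv (weakDeriv z) + ξ ∈
      subdifferential (V f ε) z + subdifferential (VD ν) z +
        subdifferential (constraintEnergy Khat δ) z := by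
  simp only [mem_subdifferential_coe_iff] at hsub
  obtain ⟨u, hu⟩ := exists_isRep_of_mem_H1 hL hϖ
  obtain ⟨v, hv⟩ := exists_isRep_of_mem_H1 hL hz.2
  have hbd := boundary_values_eq_zero hL (hf.isQuadConvex hε) hν hu hv hb hsub
  have h0 := hbd (-L) (Or.inl rfl)
  have h1 := hbd L (Or.inr rfl)
  rw [sub_eq_add_neg]
  exact add_mem_add (add_mem_add (mem_subdifferential_V hL hf hε hu h0.1 h1.1 hz.1 hsub)
    (mem_subdifferential_VD hL hz.1 hv h0.2 h1.2))
    (mem_subdifferential_constraintEnergy hK hδ hξ)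

/-! ### The elementary inclusion of the sum rule. -/

lemma totalVariation_nonneg (hL : 0 < L) (z : X L) : 0 ≤ totalVariation z := by
  refine le_sSup ⟨0, fun _ => 0, (weakDeriv_zero hL).1, X.zero_ae, continuous_const,
    HasCompactSupport.zero, by simp [tsupport], by simp, ?_⟩
  rw [(weakDeriv_zero hL).2, ← X.inner_eq, inner_zero_right]
  rfl

lemma V_nonneg (hL : 0 < L) (f : ℝ → ℝ → ℝ) (ε : ℝ) (z : X L) : 0 ≤ V f ε z := by
  unfold V
  split_ifs
  · exact totalVariation_nonneg hL z
  · exact EReal.coe_ennreal_nonneg _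
  · exact le_top

/-- Outside `H¹` the term `V^D` is infinite and the others are nonnegative, so the sum is `⊤` as
well. -/
lemma Psi_eq_add (hL : 0 < L) (f Khat : ℝ → ℝ → ℝ) (ν ε δ : ℝ) (z : X L) :
    Psi f Khat ν ε δ z = V f ε z + VD ν z + constraintEnergy Khat δ z := by
  by_cases hz : z ∈ H1 L
  · rw [Psi, if_pos hz, Phi]
  · have hV : V f ε z ≠ ⊥ := (lt_of_lt_of_le (by simp) (V_nonneg hL f ε z)).ne'
    have hC : constraintEnergy Khat δ z ≠ ⊥ :=
      (lt_of_lt_of_le (by simp) (constraintEnergy_nonneg Khat δ z)).ne'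
    rw [Psi, if_neg hz, VD_of_notMem hz, EReal.add_top_of_ne_bot hV, EReal.top_add_of_ne_bot hC]

lemma add_subset_subdifferential_Psi (hL : 0 < L) (f Khat : ℝ → ℝ → ℝ) (ν ε δ : ℝ) (z : X L) :
    subdifferential (V f ε) z + subdifferential (VD ν) z +
      subdifferential (constraintEnergy Khat δ) z ⊆ subdifferential (Psi f Khat ν ε δ) z := by
  rintro _ ⟨_, ⟨a, ha, b, hb, rfl⟩, c, hc, rfl⟩ y
  have := add_le_add (add_le_add (ha y) (hb y)) (hc y)
  rw [Psi_eq_add hL, Psi_eq_add hL]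
  refine le_trans (le_of_eq ?_) this
  simp only [inner_add_left, EReal.coe_add]
  abel

end QuasilinearEnergy

end

open QuasilinearEnergy

theorem mainTheorem1 (L : ℝ) (hL : 0 < L) (ν : ℝ) (hν : 0 < ν)
    (f : ℝ → ℝ → ℝ) (hf : IsAbsRegularization f)
    (Khat : ℝ → ℝ → ℝ) (hK : IsIndicatorRegularization Khat)
    (ε : ℝ) (hε : ε ∈ Icc (0 : ℝ) 1) (δ : ℝ) (hδ : δ ∈ Icc (0 : ℝ) 1) :
    (∀ z zs : X L, zs ∈ subdifferential (Psi f Khat ν ε δ) z ↔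
      z ∈ H2 L ∧ ∃ ϖ ξ : X L,
        ϖ ∈ H1 L ∧ MemLp ϖ ⊤ (omegaMeasure L) ∧
        VanishesAtBoundary (ϖ + ν ^ 2 • weakDeriv z) ∧
        (∀ᵐ x ∂(omegaMeasure L),
          ϖ x ∈ subdifferential (fun r : ℝ => ((f ε r : ℝ) : EReal)) (weakDeriv z x)) ∧
        (∀ᵐ x ∂(omegaMeasure L), ξ x ∈ constraintGraph Khat δ (z x)) ∧
        zs = -weakDeriv ϖ - ν ^ 2 • weakDeriv (weakDeriv z) + ξ) ∧
    (∀ z : X L, subdifferential (Psi f Khat ν ε δ) z =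
      subdifferential (V f ε) z + subdifferential (VD ν) z +
        subdifferential (constraintEnergy Khat δ) z) := by
  refine ⟨fun z zs => ⟨exists_of_mem_subdifferential_Psi hL hν hf hK hε hδ, ?_⟩,
    fun z => Subset.antisymm ?_ (add_subset_subdifferential_Psi hL f Khat ν ε δ z)⟩
  · rintro ⟨hz, ϖ, ξ, h1, _, h3, h4, h5, rfl⟩
    exact add_subset_subdifferential_Psi hL f Khat ν ε δ z
      (mem_sum_of_decomposition hL hν hf hK hε hδ hz h1 h3 h4 h5)
  · intro zs hzs
    obtain ⟨hz, ϖ, ξ, h1, _, h3, h4, h5, rfl⟩ :=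
      exists_of_mem_subdifferential_Psi hL hν hf hK hε hδ hzs
    exact mem_sum_of_decomposition hL hν hf hK hε hδ hz h1 h3 h4 h5
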